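/- Let $Q^5=\{(\mathbf q,\mathbf p)\in\mathbb R^3\times(\mathbb R^3)^*:\mathbf p\mathbf q=1\}$ (column and row vectors), let $\mathcal D\subset TQ^5$ be the rank 2 distribution $\{d\mathbf p=\mathbf q\times d\mathbf q\}$, let $M^4\subset\mathbb{RP}^2\times\mathbb{RP}^{2*}$ be the open set of pairs $([\mathbf q],[\mathbf p])$ with $\mathbf p\mathbf q\neq0$, and let $\Pi:Q^5\to M^4$, $\Pi(\mathbf q,\mathbf p)=([\mathbf q],[\mathbf p])$. Let $\mathbf g$ be the dancing metric on $M^4$, i.e. the pseudo-riemannian metric of signature $(2,2)$ for which $\Pi$ is a pseudo-riemannian submersion when $Q^5$ carries the restriction of the flat metric $-2\,d\mathbf p\,d\mathbf q$, and let $[\mathbf g]$ be its conformal class. Orient $M^4$ so that the null bases $(e_1,e_2,e^1,e^2)$ of $T_{(q,p)}M^4=T_q\mathbb{RP}^2\oplus T_p\mathbb{RP}^{2*}$ with $e_1,e_2\in T_q\mathbb{RP}^2$, $e^1,e^2\in T_p\mathbb{RP}^{2*}$ and $\langle e^a,e_b\rangle=\delta^a_b$ are positively oriented. A 2-plane $W$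 in a tangent space is self-dual if $*\beta=\beta$ for $\beta=\theta^1\wedge\theta^2$, where $\theta^1,\theta^2$ is a basis of the annihilator of $W$ and $*$ is the Hodge star. A smooth parametrized curve $\Gamma(t)=(q(t),p(t))$ in $M^4$, defined on an open interval, is non-degenerate if $q'(t)\ne0$ and $p'(t)\neq0$ for all $t$, and null if $\mathbf g(\Gamma',\Gamma')=0$. A non-degenerate null curve $\Gamma$ has, for each $t$, a unique self-dual null 2-plane $W(t)\subset T_{\Gamma(t)}M^4$ containing $\Gamma'(t)$; it has parallel self-dual tangent 2-plane if the field $W$ is parallel along $\Gamma$ for the Levi-Civita connection. Let $\tilde{\mathbf g}=\rho\,\mathbf g$, with $\rho>0$ smooth on $M^4$, be any metric in $[\mathbf g]$, and use its Levi-Civita connection. Then, for curves on any open interval $J\subset\mathbb R$: 1. If $\tilde\Gamma:J\to Q^5$ is a smooth regular integral curve of $(Q^5,\mathcal D)$ (i.e. $0\ne\tilde\Gamma'(t)\in\mathcal D_{\tilde\Gamma(t)}$ for all $t$), then $\Gamma=\Pi\circ\tilde\Gamma$ is a non-degenerate null curve in $(M^4,[\mathbf g])$ with parallel self-dual tangent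 2-plane. 2. Conversely, if $\Gamma:J\to M^4$ is a non-degenerate null curve in $(M^4,[\mathbf g])$ with parallel self-dual tangent 2-plane, then there is exactly one smooth integral curve $\tilde\Gamma:J\to Q^5$ of $(Q^5,\mathcal D)$ with $\Pi\circ\tilde\Gamma=\Gamma$; this $\tilde\Gamma$ is regular. -/

import Mathlib

open Set Topology Module
open scoped Manifold ContDiff Matrix LinearAlgebra.Projectivization

noncomputable section

/-! ## Pseudo-riemannian geometry along a curve -/

section PseudoRiemannian

variable {E : Type*} [NormedAddCommGroup E] [NormedSpace ℝ E]
  {H : Type*} [TopologicalSpace H] (I : ModelWithCorners ℝ E H)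
  {M : Type*} [TopologicalSpace M] [ChartedSpace H M]

/-- A field of bilinear forms on the tangent spaces of `M`. -/
abbrev MetricField (I : ModelWithCorners ℝ E H) (M : Type*) [TopologicalSpace M]
    [ChartedSpace H M] : Type _ :=
  ∀ m : M, TangentSpace I m →L[ℝ] TangentSpace I m →L[ℝ] ℝ

/-- The velocity `Γ'(t)` of a curve. -/
def velocity (Γ : ℝ → M) (t : ℝ) : TangentSpace I (Γ t) :=
  mfderiv 𝓘(ℝ, ℝ) I Γ t (1 : ℝ)

/-- The coordinate expression of `g` in the chart at `m₀`: the pull-back of `g` by the inverse of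
that chart, at the point `y` of the model space. (Each tangent space of `M` has `E` as its
underlying vector space.) -/
def localMetric (g : MetricField I M) (m₀ : M) (y : E) : E →L[ℝ] E →L[ℝ] ℝ :=
  let A : E →L[ℝ] E := mfderiv 𝓘(ℝ, E) I (extChartAt I m₀).symm y
  let B : E →L[ℝ] E →L[ℝ] ℝ := g ((extChartAt I m₀).symm y)
  B.bilinearComp A A

/-- The Christoffel symbols of the first kind of a metric `G` on (an open subset of) the vector
space `E`, as a covector: `z ↦ (∂_v G(w, z) + ∂_w G(v, z) - ∂_z G(v, w)) / 2`. -/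
def christoffelFirst (G : E → E →L[ℝ] E →L[ℝ] ℝ) (y v w : E) : E →L[ℝ] ℝ :=
  (1 / 2 : ℝ) • (fderiv ℝ G y v w + fderiv ℝ G y w v - ((fderiv ℝ G y).flip v).flip w)

/-- The Christoffel symbols of the second kind `Γ_y(v, w)`: the index is raised with `G`. -/
def christoffel (G : E → E →L[ℝ] E →L[ℝ] ℝ) (y v w : E) : E :=
  ContinuousLinearMap.inverse (G y) (christoffelFirst G y v w)

/-- The components, in the chart at `m₀`, of a vector field `V` along a curve `Γ`. -/
def localVectorField (Γ : ℝ → M) (V : ∀ t, TangentSpace I (Γ t)) (m₀ : M) (t : ℝ) : E :=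
  mfderiv I 𝓘(ℝ, E) (extChartAt I m₀) (Γ t) (V t)

/-- The covariant derivative at time `t` of the vector field `V` along the curve `Γ`, for the
Levi-Civita connection of `g`. It is computed in the chart at `Γ t` by the usual formula
`dVᵏ/dt + Γᵏ_{ab} (dxᵃ/dt) Vᵇ`; the tangent space at `Γ t` is, by definition, the model space `E`,
identified with the tangent space through the chart at `Γ t`. -/
def covariantDeriv (g : MetricField I M) (Γ : ℝ → M) (V : ∀ t, TangentSpace I (Γ t)) (t : ℝ) :
    TangentSpace I (Γ t) :=
  let x : ℝ → E := fun s => extChartAt I (Γ t) (Γ s)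
  let v : ℝ → E := localVectorField I Γ V (Γ t)
  let D : E := deriv v t + christoffel (localMetric I g (Γ t)) (x t) (deriv x t) (v t)
  D

variable [IsManifold I 1 M]

/-- `V` is a smooth vector field along `Γ` over the set of times `J`. -/
def IsSmoothAlong (Γ : ℝ → M) (V : ∀ t, TangentSpace I (Γ t)) (J : Set ℝ) : Prop :=
  ContMDiffOn 𝓘(ℝ, ℝ) I.tangent ∞ (fun t => (⟨Γ t, V t⟩ : TangentBundle I M)) J

/-- The smooth vector field `V` along `Γ` is a section of the field `W` of subspaces. -/
def IsSectionAlong (Γ : ℝ → M) (W : ∀ t, Submodule ℝ (TangentSpace I (Γ t))) (J : Set ℝ)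
    (V : ∀ t, TangentSpace I (Γ t)) : Prop :=
  IsSmoothAlong I Γ V J ∧ ∀ t ∈ J, V t ∈ W t

/-- The field `W` of tangent subspaces along `Γ` is smooth and parallel with respect to the
Levi-Civita connection of `g`: smooth sections exist through every vector of `W`, and the covariant
derivative along `Γ` of a smooth section of `W` is again in `W`. -/
structure IsParallelAlong (g : MetricField I M) (Γ : ℝ → M)
    (W : ∀ t, Submodule ℝ (TangentSpace I (Γ t))) (J : Set ℝ) : Prop where
  smooth : ∀ t ∈ J, ∀ w ∈ W t, ∃ V, IsSectionAlong I Γ W J V ∧ V t = w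
  parallel : ∀ V, IsSectionAlong I Γ W J V → ∀ t ∈ J, covariantDeriv I g Γ V t ∈ W t

end PseudoRiemannian

/-! ## Linear algebra in signature (2,2) -/

section LinearAlgebra22

variable {V : Type*} [AddCommGroup V] [Module ℝ V]

/-- `e = (e₁, e₂, e¹, e²)` is a null basis of a four-dimensional space with bilinear form `B`:
`⟨e_a, e_b⟩ = ⟨eᵃ, eᵇ⟩ = 0` and `⟨eᵃ, e_b⟩ = δᵃ_b`. (These relations imply linear independence.) -/
def IsNullFrame (B : V → V → ℝ) (e : Fin 4 → V) : Prop :=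
  ∀ i j, B (e i) (e j) =
    !![(0 : ℝ), 0, 1, 0;
       0, 0, 0, 1;
       1, 0, 0, 0;
       0, 1, 0, 0] i j

/-- The inner product of two covectors, for the form with null basis `e`. -/
def coInner (e : Fin 4 → V) (ξ θ : Dual ℝ V) : ℝ :=
  ξ (e 0) * θ (e 2) + ξ (e 2) * θ (e 0) + ξ (e 1) * θ (e 3) + ξ (e 3) * θ (e 1)

/-- The value of the 4-form `θ₁ ∧ θ₂ ∧ θ₃ ∧ θ₄` on `e`, that is, its ratio to the volume form
`vol = x¹ ∧ x² ∧ x₁ ∧ x₂` given by the basis dual to `e`. -/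
def wedgeFour (e : Fin 4 → V) (θ₁ θ₂ θ₃ θ₄ : Dual ℝ V) : ℝ :=
  Matrix.det (Matrix.of fun i j => (![θ₁, θ₂, θ₃, θ₄] : Fin 4 → Dual ℝ V) i (e j))

/-- `W` is a self-dual 2-plane, for the metric with null basis `e` and the orientation given by `e`.
With `β = θ₁ ∧ θ₂`, where `θ₁, θ₂` annihilate `W`, this is `*β = β`, the Hodge star being defined by
`α ∧ *β = ⟨α, β⟩ vol`; it suffices to test this on the decomposable 2-forms `α = ξ₁ ∧ ξ₂`. -/
def IsSelfDualPlane (e : Fin 4 → V) (W : Submodule ℝ V) : Prop :=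
  finrank ℝ W = 2 ∧
    ∀ θ₁ ∈ W.dualAnnihilator, ∀ θ₂ ∈ W.dualAnnihilator, ∀ ξ₁ ξ₂ : Dual ℝ V,
      wedgeFour e ξ₁ ξ₂ θ₁ θ₂ =
        coInner e ξ₁ θ₁ * coInner e ξ₂ θ₂ - coInner e ξ₁ θ₂ * coInner e ξ₂ θ₁

end LinearAlgebra22

/-! ## The real projective plane as a smooth manifold -/

/-- The space `ℝ³`. Row vectors, i.e. elements of the dual space, are also written as such triples,
the pairing being the dot product. -/
abbrev R3 : Type := Fin 3 → ℝ

/-- The space `ℝ²` on which the projective plane is modelled. -/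
abbrev R2 : Type := Fin 2 → ℝ

/-- The real projective plane; the dual projective plane is the same space, its points being given
by row vectors. -/
abbrev RP2 : Type := ℙ ℝ R3

namespace RP2

instance : TopologicalSpace RP2 :=
  inferInstanceAs (TopologicalSpace (Quotient (projectivizationSetoid ℝ R3)))

lemma isQuotientMap_mk' : IsQuotientMap (Projectivization.mk' ℝ : {v : R3 // v ≠ 0} → RP2) :=
  isQuotientMap_quotient_mk'

/-- The point of the projective plane with given homogeneous coordinates (with a junk value for the
zero vector). -/
def ofCoords (v : R3) : RP2 :=
  if h : v ≠ 0 then Projectivization.mk ℝ v h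
  else Projectivization.mk ℝ (fun _ => 1) (fun h => one_ne_zero (congrFun h 0))

/-- The affine chart `[v] ↦ (v_k / v_i)_{k ≠ i}`. -/
def affineCoord (i : Fin 3) (x : RP2) : R2 := fun k => x.rep (i.succAbove k) / x.rep i

lemma insert_ne_zero (i : Fin 3) (y : R2) : (i.insertNth (1 : ℝ) y : R3) ≠ 0 := fun h => by
  have := congrFun h i
  simp at this

/-- The inverse of the affine chart. -/
def ofAffine (i : Fin 3) (y : R2) : RP2 :=
  Projectivization.mk ℝ (i.insertNth (1 : ℝ) y : R3) (insert_ne_zero i y)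

lemma rep_mk_eq (v : R3) (hv : v ≠ 0) :
    ∃ a : ℝ, a ≠ 0 ∧ (Projectivization.mk ℝ v hv).rep = a • v := by
  obtain ⟨a, ha⟩ := Projectivization.exists_smul_eq_mk_rep ℝ v hv
  exact ⟨a, a.ne_zero, ha.symm⟩

lemma rep_mk_ne_zero_iff (v : R3) (hv : v ≠ 0) (i : Fin 3) :
    (Projectivization.mk ℝ v hv).rep i ≠ 0 ↔ v i ≠ 0 := by
  obtain ⟨a, ha, h⟩ := rep_mk_eq v hv
  simp [h, ha]

lemma affineCoord_mk (v : R3) (hv : v ≠ 0) (i : Fin 3) :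
    affineCoord i (Projectivization.mk ℝ v hv) = fun k => v (i.succAbove k) / v i := by
  obtain ⟨a, ha, h⟩ := rep_mk_eq v hv
  funext k
  simp only [affineCoord, h, Pi.smul_apply, smul_eq_mul]
  exact mul_div_mul_left _ _ ha

lemma continuous_insert (i : Fin 3) : Continuous fun y : R2 => (i.insertNth (1 : ℝ) y : R3) :=
  continuous_const.finInsertNth i continuous_id

lemma isOpen_source (i : Fin 3) : IsOpen {x : RP2 | x.rep i ≠ 0} := by
  rw [← isQuotientMap_mk'.isOpen_preimage]
  have : (Projectivization.mk' ℝ : {v : R3 // v ≠ 0} → RP2) ⁻¹' {x : RP2 | x.rep i ≠ 0} =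
      {v : {v : R3 // v ≠ 0} | (v : R3) i ≠ 0} := by
    ext v
    exact rep_mk_ne_zero_iff v v.2 i
  rw [this]
  exact isOpen_ne_fun ((continuous_apply i).comp continuous_subtype_val) continuous_const

/-- The affine chart on the open set `v_i ≠ 0` of the projective plane. -/
def chart (i : Fin 3) : OpenPartialHomeomorph RP2 R2 where
  toFun := affineCoord i
  invFun := ofAffine i
  source := {x | x.rep i ≠ 0}
  target := univ
  map_source' _ _ := mem_univ _
  map_target' y _ := by
    refine (rep_mk_ne_zero_iff _ (insert_ne_zero i y) i).2 ?_
    simp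
  left_inv' x hx := by
    have hx' : x.rep i ≠ 0 := hx
    conv_rhs => rw [← x.mk_rep]
    refine (Projectivization.mk_eq_mk_iff' ℝ _ _ _ _).2 ⟨(x.rep i)⁻¹, ?_⟩
    funext k
    refine Fin.succAboveCases i ?_ (fun k => ?_) k
    · simp [hx']
    · simp [affineCoord, div_eq_inv_mul]
  right_inv' y _ := by
    rw [ofAffine, affineCoord_mk]
    funext k
    simp
  open_source := isOpen_source i
  open_target := isOpen_univ
  continuousOn_toFun := by
    rw [isQuotientMap_mk'.continuousOn_isOpen_iff (isOpen_source i)]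
    have h : ContinuousOn (fun v : {v : R3 // v ≠ 0} => fun k : Fin 2 =>
        (v : R3) (i.succAbove k) / (v : R3) i)
        ((Projectivization.mk' ℝ : {v : R3 // v ≠ 0} → RP2) ⁻¹' {x : RP2 | x.rep i ≠ 0}) := by
      refine continuousOn_pi.2 fun k => ContinuousOn.div ?_ ?_ ?_
      · exact ((continuous_apply _).comp continuous_subtype_val).continuousOn
      · exact ((continuous_apply _).comp continuous_subtype_val).continuousOn
      · intro v hv
        exact (rep_mk_ne_zero_iff v v.2 i).1 hv
    refine h.congr fun v _ => ?_
    exact affineCoord_mk v v.2 i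
  continuousOn_invFun :=
    (isQuotientMap_mk'.continuous.comp
      ((continuous_insert i).subtype_mk (insert_ne_zero i))).continuousOn

lemma exists_rep_ne_zero (x : RP2) : ∃ i, x.rep i ≠ 0 := by
  by_contra! h
  exact x.rep_nonzero (funext h)

/-- The index of a non-zero homogeneous coordinate of `x`, used for the preferred chart at `x`. -/
def index (x : RP2) : Fin 3 := (exists_rep_ne_zero x).choose

lemma rep_index_ne_zero (x : RP2) : x.rep (index x) ≠ 0 := (exists_rep_ne_zero x).choose_spec

instance : ChartedSpace R2 RP2 where
  atlas := range chart
  chartAt x := chart (index x)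
  mem_chart_source x := rep_index_ne_zero x
  chart_mem_atlas _ := mem_range_self _

instance : IsManifold 𝓘(ℝ, R2) ∞ RP2 := by
  apply isManifold_of_contDiffOn
  rintro _ _ ⟨i, rfl⟩ ⟨j, rfl⟩
  have key : ContDiffOn ℝ ∞ (fun y : R2 => fun k : Fin 2 =>
      (i.insertNth (1 : ℝ) y : R3) (j.succAbove k) / (i.insertNth (1 : ℝ) y : R3) j)
      {y | (i.insertNth (1 : ℝ) y : R3) j ≠ 0} := by
    have hc : ∀ l : Fin 3, ContDiff ℝ ∞ fun y : R2 => (i.insertNth (1 : ℝ) y : R3) l := by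
      intro l
      refine Fin.succAboveCases i ?_ (fun l => ?_) l
      · simpa using contDiff_const
      · simpa using contDiff_apply ℝ ℝ l
    exact contDiffOn_pi.2 fun k => (hc _).contDiffOn.div (hc _).contDiffOn fun y hy => hy
  refine (key.mono ?_).congr ?_
  · rintro y ⟨hy, -⟩
    have hy' : (ofAffine i y).rep j ≠ 0 := hy.2
    exact (rep_mk_ne_zero_iff _ (insert_ne_zero i y) j).1 hy'
  · intro y _
    exact affineCoord_mk _ (insert_ne_zero i y) j

end RP2

/-! ## The quadric `Q⁵`, its distribution, and the pseudo-Hopf fibration -/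

/-- The quadric `Q⁵ = {(q, p) : p q = 1}` in `ℝ³ × (ℝ³)*`. -/
def Q5 : Set (R3 × R3) := {x | x.2 ⬝ᵥ x.1 = 1}

/-- The distribution `𝒟` on `Q⁵`: its value at `x = (q, p)` is the space of those vectors `(u, w)`
tangent to `Q⁵` for which `w = q × u`. -/
def distD (x : R3 × R3) : Submodule ℝ (R3 × R3) where
  carrier := {ξ | ξ.2 ⬝ᵥ x.1 + x.2 ⬝ᵥ ξ.1 = 0 ∧ ξ.2 = crossProduct x.1 ξ.1}
  add_mem' {a b} ha hb := by
    refine ⟨?_, ?_⟩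
    · have h1 := ha.1
      have h2 := hb.1
      simp only [Prod.fst_add, Prod.snd_add, add_dotProduct, dotProduct_add]
      linarith
    · simp [ha.2, hb.2]
  zero_mem' := by simp
  smul_mem' c a ha := by
    refine ⟨?_, ?_⟩
    · have h1 := ha.1
      simp only [Prod.smul_fst, Prod.smul_snd, smul_dotProduct, dotProduct_smul, smul_eq_mul]
      linear_combination c * h1
    · simp [ha.2]

/-- `γ` is a smooth parametrized integral curve of `(Q⁵, 𝒟)` over the interval `J`. -/
structure IsIntegralCurveD (γ : ℝ → R3 × R3) (J : Set ℝ) : Prop where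
  smooth : ContDiffOn ℝ ∞ γ J
  mem : ∀ t ∈ J, γ t ∈ Q5
  tangent : ∀ t ∈ J, deriv γ t ∈ distD (γ t)

/-- The model with corners of the 4-manifold `ℝP² × ℝP²*`. -/
abbrev I4 : ModelWithCorners ℝ (R2 × R2) (ModelProd R2 R2) := 𝓘(ℝ, R2).prod 𝓘(ℝ, R2)

/-- The open set `M⁴ ⊂ ℝP² × ℝP²*` of non-incident point-line pairs. -/
def M4 : Set (RP2 × RP2) := {m | m.2.rep ⬝ᵥ m.1.rep ≠ 0}

/-- The projection `Π(q, p) = ([q], [p])`. -/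
def hopf (x : R3 × R3) : RP2 × RP2 := (RP2.ofCoords x.1, RP2.ofCoords x.2)

/-! ## The dancing metric -/

/-- The local section of `Π : Q⁵ → M⁴` obtained from the affine charts with indices `i`, `j`, by
`([a], [b]) ↦ (a, b / (b a))` where `a_i = b_j = 1`. -/
def localSection (i j : Fin 3) (m : RP2 × RP2) : R3 × R3 :=
  let a : R3 := i.insertNth (1 : ℝ) (RP2.affineCoord i m.1)
  let b : R3 := j.insertNth (1 : ℝ) (RP2.affineCoord j m.2)
  (a, (b ⬝ᵥ a)⁻¹ • b)

/-- The point of `Q⁵` above `m` at which the metric is computed. -/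
def basePoint (m : RP2 × RP2) : R3 × R3 := localSection (RP2.index m.1) (RP2.index m.2) m

/-- The projection of `T_x Q⁵`, `x = (q, p)`, to the horizontal space
`{(u, w) : p u = 0, w q = 0}`, the orthogonal complement in `T_x Q⁵` of the tangent `(q, -p)` to
the fibre of `Π`. -/
def horizontalPart (x : R3 × R3) : (R3 × R3) →ₗ[ℝ] (R3 × R3) where
  toFun ξ := (ξ.1 - (x.2 ⬝ᵥ ξ.1) • x.1, ξ.2 - (ξ.2 ⬝ᵥ x.1) • x.2)
  map_add' ξ ζ := by
    ext k <;> simp [dotProduct_add, add_dotProduct] <;> ring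
  map_smul' c ξ := by
    ext k <;> simp [dotProduct_smul, smul_dotProduct] <;> ring

/-- The horizontal lift of tangent vectors at `m` to `T Q⁵` at `basePoint m`, for `m ∈ M⁴`. -/
def horizontalLift (m : RP2 × RP2) : TangentSpace I4 m →ₗ[ℝ] R3 × R3 :=
  let s : TangentSpace I4 m →L[ℝ] R3 × R3 :=
    mfderiv I4 𝓘(ℝ, R3 × R3) (localSection (RP2.index m.1) (RP2.index m.2)) m
  horizontalPart (basePoint m) ∘ₗ s.toLinearMap

/-- The flat metric `-2 dp dq` on `ℝ³ × (ℝ³)*`, as a symmetric bilinear form. -/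
def flatMetric : (R3 × R3) →ₗ[ℝ] (R3 × R3) →ₗ[ℝ] ℝ :=
  LinearMap.mk₂ ℝ (fun ξ ζ => -(ξ.2 ⬝ᵥ ζ.1 + ζ.2 ⬝ᵥ ξ.1))
    (fun a b c => by simp [add_dotProduct, dotProduct_add]; ring)
    (fun a b c => by simp [smul_dotProduct, dotProduct_smul]; ring)
    (fun a b c => by simp [add_dotProduct, dotProduct_add]; ring)
    (fun a b c => by simp [smul_dotProduct, dotProduct_smul]; ring)

/-- The dancing metric on `M⁴`: the metric for which `Π : Q⁵ → M⁴` is a pseudo-riemannian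
submersion, `Q⁵` carrying the restriction of the flat metric. (Only its values on the open set `M⁴`
are meaningful.) -/
def dancingMetric : MetricField I4 (RP2 × RP2) := fun m =>
  let B : (R2 × R2) →ₗ[ℝ] (R2 × R2) →ₗ[ℝ] ℝ :=
    flatMetric.compl₁₂ (horizontalLift m) (horizontalLift m)
  B.toContinuousBilinearMap

/-- The metric `ρ · g` conformal to the dancing metric. -/
def conformalMetric (ρ : RP2 × RP2 → ℝ) : MetricField I4 (RP2 × RP2) :=
  fun m => ρ m • dancingMetric m

/-! ## Null curves in `M⁴` -/

/-- The value at `m` of a field of bilinear forms, as a plain function. -/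
def metricAt (g : MetricField I4 (RP2 × RP2)) (m : RP2 × RP2)
    (v w : TangentSpace I4 m) : ℝ := g m v w

/-- The null bases `(e₁, e₂, e¹, e²)` of `T_m M⁴` with `e₁, e₂` tangent to `ℝP²` and `e¹, e²` tangent
to `ℝP²*`. They define the orientation of `M⁴`. -/
def IsPositiveNullFrame (g : MetricField I4 (RP2 × RP2)) (m : RP2 × RP2)
    (e : Fin 4 → TangentSpace I4 m) : Prop :=
  IsNullFrame (metricAt g m) e ∧
    (∀ k : Fin 4, k < 2 → mfderiv I4 𝓘(ℝ, R2) (Prod.snd : RP2 × RP2 → RP2) m (e k) = 0) ∧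
    (∀ k : Fin 4, 2 ≤ k → mfderiv I4 𝓘(ℝ, R2) (Prod.fst : RP2 × RP2 → RP2) m (e k) = 0)

/-- `W` is a self-dual null 2-plane in `T_m M⁴`. -/
def IsSDNullPlane (g : MetricField I4 (RP2 × RP2)) (m : RP2 × RP2)
    (W : Submodule ℝ (TangentSpace I4 m)) : Prop :=
  (∀ v ∈ W, metricAt g m v v = 0) ∧ ∃ e, IsPositiveNullFrame g m e ∧ IsSelfDualPlane e W

/-- `Γ` is a smooth parametrized curve in `M⁴` over the interval `J`. -/
structure IsCurveInM4 (Γ : ℝ → RP2 × RP2) (J : Set ℝ) : Prop where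
  smooth : ContMDiffOn 𝓘(ℝ, ℝ) I4 ∞ Γ J
  mem : ∀ t ∈ J, Γ t ∈ M4

/-- `Γ(t) = (q(t), p(t))` is non-degenerate: `q'(t) ≠ 0` and `p'(t) ≠ 0` for all `t`. -/
def IsNondegenerate (Γ : ℝ → RP2 × RP2) (J : Set ℝ) : Prop :=
  ∀ t ∈ J, velocity 𝓘(ℝ, R2) (fun s => (Γ s).1) t ≠ 0 ∧
    velocity 𝓘(ℝ, R2) (fun s => (Γ s).2) t ≠ 0

/-- `Γ` is a null curve. -/
def IsNullCurve (g : MetricField I4 (RP2 × RP2)) (Γ : ℝ → RP2 × RP2) (J : Set ℝ) : Prop :=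
  ∀ t ∈ J, metricAt g (Γ t) (velocity I4 Γ t) (velocity I4 Γ t) = 0

/-- The self-dual null 2-plane tangent to the null curve `Γ` (the one that contains `Γ'(t)`) is
parallel along `Γ`. -/
def HasParallelSDTangentPlane (g : MetricField I4 (RP2 × RP2)) (Γ : ℝ → RP2 × RP2)
    (J : Set ℝ) : Prop :=
  ∃ W : ∀ t, Submodule ℝ (TangentSpace I4 (Γ t)),
    (∀ t ∈ J, IsSDNullPlane g (Γ t) (W t) ∧ velocity I4 Γ t ∈ W t) ∧
    IsParallelAlong I4 g Γ W J

/-- Non-degenerate null curves in `M⁴` with parallel self-dual tangent null 2-plane. -/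
structure IsHalfGeodesic (g : MetricField I4 (RP2 × RP2)) (Γ : ℝ → RP2 × RP2)
    (J : Set ℝ) : Prop where
  curve : IsCurveInM4 Γ J
  nondegenerate : IsNondegenerate Γ J
  null : IsNullCurve g Γ J
  parallel : HasParallelSDTangentPlane g Γ J

end

/-! ## Affine coordinates of points given by homogeneous coordinates -/

/-- The affine coordinates of the point with homogeneous coordinates `q`. -/
noncomputable def homChart (i : Fin 3) (q : R3) : R2 := fun k => q (i.succAbove k) / q i

/-- The derivative of `homChart i` at `q`. -/
noncomputable def homChartDeriv (i : Fin 3) (q : R3) : R3 →L[ℝ] R2 :=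
  ContinuousLinearMap.pi fun k =>
    (q i)⁻¹ • ContinuousLinearMap.proj (i.succAbove k) -
      (q (i.succAbove k) / q i ^ 2) • ContinuousLinearMap.proj i

/-- The derivative of the affine parametrization `y ↦ i.insertNth 1 y`. -/
noncomputable def insDir (i : Fin 3) : R2 →L[ℝ] R3 :=
  LinearMap.toContinuousLinearMap
    { toFun := fun u => i.insertNth (0 : ℝ) u
      map_add' := fun u v => by
        funext k
        refine Fin.succAboveCases i ?_ (fun k => ?_) k <;> simp
      map_smul' := fun c u => by
        funext k
        refine Fin.succAboveCases i ?_ (fun k => ?_) k <;> simp }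

/-- The affine parametrization of the projective plane, in homogeneous coordinates. -/
def affinePt (i : Fin 3) (y : R2) : R3 := i.insertNth (1 : ℝ) y

lemma fin3_ext (i : Fin 3) {a b : R3} (h : a i = b i)
    (h' : ∀ k : Fin 2, a (i.succAbove k) = b (i.succAbove k)) : a = b := by
  funext k
  refine Fin.succAboveCases i h (fun k => h' k) k

@[simp] lemma insDir_self (i : Fin 3) (u : R2) : insDir i u i = 0 := by
  simp [insDir]

@[simp] lemma insDir_succAbove (i : Fin 3) (u : R2) (k : Fin 2) :
    insDir i u (i.succAbove k) = u k := by
  simp [insDir]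

@[simp] lemma affinePt_self (i : Fin 3) (u : R2) : affinePt i u i = 1 := by
  simp [affinePt]

@[simp] lemma affinePt_succAbove (i : Fin 3) (u : R2) (k : Fin 2) :
    affinePt i u (i.succAbove k) = u k := by
  simp [affinePt]

lemma homChartDeriv_apply (i : Fin 3) (q α : R3) (k : Fin 2) :
    homChartDeriv i q α k =
      (q i)⁻¹ * α (i.succAbove k) - q (i.succAbove k) / q i ^ 2 * α i := by
  simp [homChartDeriv]

lemma affinePt_ne_zero (i : Fin 3) (y : R2) : affinePt i y ≠ 0 := RP2.insert_ne_zero i y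

lemma affinePt_add (i : Fin 3) (y u : R2) : affinePt i (y + u) = affinePt i y + insDir i u :=
  fin3_ext i (by simp) (by simp)

lemma contDiff_affinePt (i : Fin 3) : ContDiff ℝ ∞ (affinePt i) := by
  have h : affinePt i = fun y => affinePt i 0 + insDir i y := by
    funext y
    rw [← affinePt_add, zero_add]
  rw [h]
  exact contDiff_const.add (insDir i).contDiff

lemma hasFDerivAt_homChart {i : Fin 3} {q : R3} (h : q i ≠ 0) :
    HasFDerivAt (homChart i) (homChartDeriv i q) q := by
  rw [hasFDerivAt_pi']
  intro k
  have h1 : HasFDerivAt (fun q : R3 => q (i.succAbove k))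
    (ContinuousLinearMap.proj (R := ℝ) (φ := fun _ : Fin 3 => ℝ) (i.succAbove k)) q :=
    (ContinuousLinearMap.proj (R := ℝ) (φ := fun _ : Fin 3 => ℝ) (i.succAbove k)).hasFDerivAt
  have h2 : HasFDerivAt (fun q : R3 => q i)
    (ContinuousLinearMap.proj (R := ℝ) (φ := fun _ : Fin 3 => ℝ) i) q :=
    (ContinuousLinearMap.proj (R := ℝ) (φ := fun _ : Fin 3 => ℝ) i).hasFDerivAt
  refine (h1.mul ((hasDerivAt_inv h).comp_hasFDerivAt q h2)).congr_fderiv ?_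
  ext v
  simp [homChartDeriv_apply]
  field_simp
  ring

lemma contDiffAt_homChart {i : Fin 3} {q : R3} (h : q i ≠ 0) :
    ContDiffAt ℝ ∞ (homChart i) q :=
  contDiffAt_pi.2 fun _ => ContDiffAt.div (contDiff_apply ℝ ℝ _).contDiffAt
    (contDiff_apply ℝ ℝ _).contDiffAt h

lemma homChart_smul (i : Fin 3) (q : R3) {c : ℝ} (hc : c ≠ 0) :
    homChart i (c • q) = homChart i q := by
  funext k
  simp [homChart, mul_div_mul_left _ _ hc]

lemma affinePt_homChart {i : Fin 3} {q : R3} (h : q i ≠ 0) :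
    affinePt i (homChart i q) = (q i)⁻¹ • q :=
  fin3_ext i (by simp [h]) (fun k => by simp [homChart, div_eq_inv_mul])

lemma homChart_affinePt (i : Fin 3) (y : R2) : homChart i (affinePt i y) = y := by
  funext k
  simp [homChart]

lemma insDir_homChartDeriv {i : Fin 3} {q : R3} (h : q i ≠ 0) (α : R3) :
    insDir i (homChartDeriv i q α) = (q i)⁻¹ • (α - (α i / q i) • q) := by
  refine fin3_ext i ?_ fun k => ?_
  · simp [h]
  · simp [homChartDeriv_apply]
    field_simp

lemma homChartDeriv_self {i : Fin 3} {q : R3} (h : q i ≠ 0) : homChartDeriv i q q = 0 := by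
  funext k
  simp only [homChartDeriv_apply, Pi.zero_apply]
  field_simp
  ring

lemma homChartDeriv_eq_zero {i : Fin 3} {q α : R3} (h : q i ≠ 0)
    (h0 : homChartDeriv i q α = 0) : α = (α i / q i) • q := by
  have h1 := insDir_homChartDeriv h α
  rw [h0, map_zero] at h1
  have h2 := (smul_eq_zero.1 h1.symm).resolve_left (inv_ne_zero h)
  exact sub_eq_zero.1 h2

/-- The Christoffel symbols of the projectively flat connection on the plane of points `a` not on
the line `b`, in the affine coordinates of index `i`. -/
noncomputable def projConn (i : Fin 3) (a b : R3) (u v : R2) : R2 :=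
  -((b ⬝ᵥ insDir i u / (b ⬝ᵥ a)) • v + (b ⬝ᵥ insDir i v / (b ⬝ᵥ a)) • u)

lemma projConn_smul (i : Fin 3) (a b : R3) (u v : R2) {c : ℝ} (hc : c ≠ 0) :
    projConn i a (c • b) u v = projConn i a b u v := by
  simp only [projConn, smul_dotProduct, smul_eq_mul, mul_div_mul_left _ _ hc]

lemma hasDerivAt_homChartDeriv {i : Fin 3} {q α : ℝ → R3} {q' α' : R3} {t : ℝ}
    (hq : HasDerivAt q q' t) (hα : HasDerivAt α α' t) (h : q t i ≠ 0) :
    HasDerivAt (fun s => homChartDeriv i (q s) (α s))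
      (homChartDeriv i (q t) α' - (α t i / q t i) • homChartDeriv i (q t) q' -
        (q' i / q t i) • homChartDeriv i (q t) (α t)) t := by
  rw [hasDerivAt_pi]
  intro k
  have hq1 := hasDerivAt_pi.1 hq
  have hα1 := hasDerivAt_pi.1 hα
  simp only [homChartDeriv_apply]
  refine (((hq1 i).fun_inv h).mul (hα1 (i.succAbove k))).sub
    (((hq1 (i.succAbove k)).div ((hq1 i).fun_pow 2) (pow_ne_zero 2 h)).mul (hα1 i))
      |>.congr_deriv ?_
  simp only [homChartDeriv_apply, Pi.sub_apply, Pi.smul_apply, Pi.div_apply, smul_eq_mul]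
  field_simp
  ring

/-- The covariant derivative for `projConn` of the vector field given by the homogeneous vector
field `α` along the curve with homogeneous coordinates `q`. -/
lemma homChartDeriv_covariant {i : Fin 3} {q α q' α' p : R3} (h : q i ≠ 0) (hpq : p ⬝ᵥ q = 1)
    (hpα : p ⬝ᵥ α = 0) :
    homChartDeriv i q α' - (α i / q i) • homChartDeriv i q q' -
        (q' i / q i) • homChartDeriv i q α +
      projConn i (affinePt i (homChart i q)) p (homChartDeriv i q q') (homChartDeriv i q α) =
    homChartDeriv i q (α' - (p ⬝ᵥ q') • α) := by
  have h1 : p ⬝ᵥ insDir i (homChartDeriv i q α) / (p ⬝ᵥ affinePt i (homChart i q)) =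
      - (α i / q i) := by
    rw [insDir_homChartDeriv h, affinePt_homChart h]
    simp only [dotProduct_smul, dotProduct_sub, hpq, hpα, smul_eq_mul]
    field_simp
    ring
  have h2 : p ⬝ᵥ insDir i (homChartDeriv i q q') / (p ⬝ᵥ affinePt i (homChart i q)) =
      p ⬝ᵥ q' - q' i / q i := by
    rw [insDir_homChartDeriv h, affinePt_homChart h]
    simp only [dotProduct_smul, dotProduct_sub, hpq, smul_eq_mul]
    field_simp
  rw [projConn, h1, h2, map_sub, map_smul]
  module

/-! ## The projections in charts -/

namespace RP2

lemma ofCoords_of_ne_zero {q : R3} (hq : q ≠ 0) : ofCoords q = Projectivization.mk ℝ q hq :=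
  dif_pos hq

lemma affineCoord_ofCoords (i : Fin 3) {q : R3} (hq : q ≠ 0) :
    affineCoord i (ofCoords q) = homChart i q := by
  rw [ofCoords_of_ne_zero hq, affineCoord_mk]
  rfl

lemma ofAffine_eq (i : Fin 3) (y : R2) : ofAffine i y = ofCoords (affinePt i y) := by
  rw [ofCoords_of_ne_zero (affinePt_ne_zero i y)]
  rfl

lemma exists_rep_ofCoords {q : R3} (hq : q ≠ 0) : ∃ a : ℝ, a ≠ 0 ∧ (ofCoords q).rep = a • q := by
  rw [ofCoords_of_ne_zero hq]
  exact rep_mk_eq q hq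

lemma rep_ofCoords_ne_zero_iff {q : R3} (hq : q ≠ 0) (i : Fin 3) :
    (ofCoords q).rep i ≠ 0 ↔ q i ≠ 0 := by
  rw [ofCoords_of_ne_zero hq]
  exact rep_mk_ne_zero_iff q hq i

lemma ofCoords_smul {c : ℝ} (hc : c ≠ 0) {q : R3} (hq : q ≠ 0) :
    ofCoords (c • q) = ofCoords q := by
  rw [ofCoords_of_ne_zero hq, ofCoords_of_ne_zero (smul_ne_zero hc hq),
    Projectivization.mk_eq_mk_iff']
  exact ⟨c, rfl⟩

lemma exists_smul_of_ofCoords_eq {q q' : R3} (hq : q ≠ 0) (hq' : q' ≠ 0)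
    (h : ofCoords q' = ofCoords q) : ∃ c : ℝ, q' = c • q := by
  rw [ofCoords_of_ne_zero hq, ofCoords_of_ne_zero hq', Projectivization.mk_eq_mk_iff'] at h
  obtain ⟨c, hc⟩ := h
  exact ⟨c, hc.symm⟩

lemma ofCoords_affinePt_affineCoord {i : Fin 3} {x : RP2} (h : x.rep i ≠ 0) :
    ofCoords (affinePt i (affineCoord i x)) = x := by
  rw [← ofAffine_eq]
  exact (chart i).left_inv h

lemma chart_mem_maximalAtlas (i : Fin 3) :
    chart i ∈ IsManifold.maximalAtlas 𝓘(ℝ, R2) ∞ RP2 :=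
  IsManifold.subset_maximalAtlas (mem_range_self i)

lemma contMDiffAt_ofCoords {q : R3} (hq : q ≠ 0) :
    ContMDiffAt 𝓘(ℝ, R3) 𝓘(ℝ, R2) ∞ ofCoords q := by
  obtain ⟨i, hi⟩ : ∃ i, q i ≠ 0 := by
    by_contra! h
    exact hq (funext h)
  have h1 : ContMDiffAt 𝓘(ℝ, R3) 𝓘(ℝ, R2) ∞ (fun q => (chart i).symm (homChart i q)) q :=
    ContMDiffAt.comp (I' := 𝓘(ℝ, R2)) q
      (contMDiffAt_symm_of_mem_maximalAtlas (chart_mem_maximalAtlas i) (mem_univ _))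
      (contDiffAt_homChart hi).contMDiffAt
  refine h1.congr_of_eventuallyEq ?_
  have h2 : ∀ᶠ q' in 𝓝 q, q' i ≠ 0 := (continuous_apply i).continuousAt.eventually_ne hi
  filter_upwards [h2] with q' hq'
  have hne : q' ≠ 0 := fun h => hq' (by simp [h])
  have h3 := ofCoords_affinePt_affineCoord ((rep_ofCoords_ne_zero_iff hne i).2 hq')
  rw [affineCoord_ofCoords i hne, ← ofAffine_eq] at h3
  exact h3.symm

lemma contMDiffAt_affineCoord {i : Fin 3} {x : RP2} (h : x.rep i ≠ 0) :
    ContMDiffAt 𝓘(ℝ, R2) 𝓘(ℝ, R2) ∞ (affineCoord i) x :=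
  contMDiffAt_of_mem_maximalAtlas (chart_mem_maximalAtlas i) h

end RP2

/-- The affine coordinates of the point of `ℝP² × ℝP²*` with given homogeneous coordinates. -/
noncomputable def hopfChart (i j : Fin 3) (z : R3 × R3) : R2 × R2 :=
  (homChart i z.1, homChart j z.2)

/-- The derivative of `hopfChart`. -/
noncomputable def hopfChartDeriv (i j : Fin 3) (z : R3 × R3) : R3 × R3 →L[ℝ] R2 × R2 :=
  (homChartDeriv i z.1).prodMap (homChartDeriv j z.2)

lemma hasFDerivAt_hopfChart {i j : Fin 3} {z : R3 × R3} (h1 : z.1 i ≠ 0) (h2 : z.2 j ≠ 0) :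
    HasFDerivAt (hopfChart i j) (hopfChartDeriv i j z) z :=
  ((hasFDerivAt_homChart h1).comp z hasFDerivAt_fst).prodMk
    ((hasFDerivAt_homChart h2).comp z hasFDerivAt_snd)

lemma contMDiffAt_hopf {z : R3 × R3} (h1 : z.1 ≠ 0) (h2 : z.2 ≠ 0) :
    ContMDiffAt 𝓘(ℝ, R3 × R3) I4 ∞ hopf z :=
  ((RP2.contMDiffAt_ofCoords h1).comp z contDiffAt_fst.contMDiffAt).prodMk
    ((RP2.contMDiffAt_ofCoords h2).comp z contDiffAt_snd.contMDiffAt)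

lemma mdifferentiableAt_hopf {z : R3 × R3} (h1 : z.1 ≠ 0) (h2 : z.2 ≠ 0) :
    MDifferentiableAt 𝓘(ℝ, R3 × R3) I4 hopf z :=
  (contMDiffAt_hopf h1 h2).mdifferentiableAt (by simp)

lemma extChartAt_apply_I4 (m x : RP2 × RP2) :
    extChartAt I4 m x =
      (RP2.affineCoord (RP2.index m.1) x.1, RP2.affineCoord (RP2.index m.2) x.2) := by
  rw [extChartAt_prod]
  rfl

lemma extChartAt_symm_apply_I4 (m : RP2 × RP2) (y : R2 × R2) :
    (extChartAt I4 m).symm y =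
      hopf (affinePt (RP2.index m.1) y.1, affinePt (RP2.index m.2) y.2) := by
  rw [extChartAt_prod, hopf, ← RP2.ofAffine_eq, ← RP2.ofAffine_eq]
  rfl

lemma mem_extChartAt_source_I4 {m x : RP2 × RP2} :
    x ∈ (extChartAt I4 m).source ↔ x.1.rep (RP2.index m.1) ≠ 0 ∧ x.2.rep (RP2.index m.2) ≠ 0 := by
  rw [extChartAt_prod, PartialEquiv.prod_source, extChartAt_source, extChartAt_source]
  rfl

lemma extChartAt_hopf (m : RP2 × RP2) {z : R3 × R3} (h1 : z.1 ≠ 0) (h2 : z.2 ≠ 0) :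
    extChartAt I4 m (hopf z) = hopfChart (RP2.index m.1) (RP2.index m.2) z := by
  rw [extChartAt_apply_I4, hopf, RP2.affineCoord_ofCoords _ h1, RP2.affineCoord_ofCoords _ h2]
  rfl

lemma hopf_mem_extChartAt_source {m : RP2 × RP2} {z : R3 × R3} (h1 : z.1 ≠ 0) (h2 : z.2 ≠ 0) :
    hopf z ∈ (extChartAt I4 m).source ↔ z.1 (RP2.index m.1) ≠ 0 ∧ z.2 (RP2.index m.2) ≠ 0 := by
  rw [mem_extChartAt_source_I4, hopf, RP2.rep_ofCoords_ne_zero_iff h1,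
    RP2.rep_ofCoords_ne_zero_iff h2]

/-- The derivative of `hopf`, the tangent spaces of `ℝP² × ℝP²*` being identified with `ℝ² × ℝ²`. -/
noncomputable def dhopf (z : R3 × R3) : R3 × R3 →L[ℝ] R2 × R2 :=
  hopfChartDeriv (RP2.index (hopf z).1) (RP2.index (hopf z).2) z

lemma mfderiv_extChartAt_mfderiv_hopf {m : RP2 × RP2} {z : R3 × R3}
    (h1 : z.1 (RP2.index m.1) ≠ 0) (h2 : z.2 (RP2.index m.2) ≠ 0) (ξ : R3 × R3) :
    mfderiv I4 𝓘(ℝ, R2 × R2) (extChartAt I4 m) (hopf z) (mfderiv 𝓘(ℝ, R3 × R3) I4 hopf z ξ) =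
      hopfChartDeriv (RP2.index m.1) (RP2.index m.2) z ξ := by
  have hz1 : z.1 ≠ 0 := fun h => h1 (by simp [h])
  have hz2 : z.2 ≠ 0 := fun h => h2 (by simp [h])
  have hm : MDifferentiableAt I4 𝓘(ℝ, R2 × R2) (extChartAt I4 m) (hopf z) := by
    refine mdifferentiableAt_extChartAt ?_
    rw [← extChartAt_source I4, hopf_mem_extChartAt_source hz1 hz2]
    exact ⟨h1, h2⟩
  have h3 := mfderiv_comp_apply z hm (mdifferentiableAt_hopf hz1 hz2) ξ
  refine h3.symm.trans ?_
  have h4 : (extChartAt I4 m) ∘ hopf =ᶠ[𝓝 z]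
      hopfChart (RP2.index m.1) (RP2.index m.2) := by
    have e1 : ∀ᶠ w : R3 × R3 in 𝓝 z, w.1 ≠ 0 := continuousAt_fst.eventually_ne hz1
    have e2 : ∀ᶠ w : R3 × R3 in 𝓝 z, w.2 ≠ 0 := continuousAt_snd.eventually_ne hz2
    filter_upwards [e1, e2] with w hw1 hw2
    exact extChartAt_hopf m hw1 hw2
  have h5 := h4.mfderiv_eq (I := 𝓘(ℝ, R3 × R3)) (I' := 𝓘(ℝ, R2 × R2))
  rw [mfderiv_eq_fderiv, mfderiv_eq_fderiv, (hasFDerivAt_hopfChart h1 h2).fderiv] at h5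
  have h6 := congrArg (fun A : R3 × R3 →L[ℝ] R2 × R2 => A ξ) h5
  rw [mfderiv_eq_fderiv]
  exact h6

lemma index_hopf_ne_zero {z : R3 × R3} (h1 : z.1 ≠ 0) (h2 : z.2 ≠ 0) :
    z.1 (RP2.index (hopf z).1) ≠ 0 ∧ z.2 (RP2.index (hopf z).2) ≠ 0 :=
  (hopf_mem_extChartAt_source h1 h2).1 (mem_extChartAt_source (I := I4) (hopf z))

lemma mfderiv_hopf {z : R3 × R3} (h1 : z.1 ≠ 0) (h2 : z.2 ≠ 0) :
    mfderiv 𝓘(ℝ, R3 × R3) I4 hopf z = dhopf z := by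
  obtain ⟨h3, h4⟩ := index_hopf_ne_zero h1 h2
  refine ContinuousLinearMap.ext fun ξ => ?_
  have h := mfderiv_extChartAt_mfderiv_hopf h3 h4 ξ
  have h5 := congrArg (fun A : R2 × R2 →L[ℝ] R2 × R2 =>
    A (mfderiv 𝓘(ℝ, R3 × R3) I4 hopf z ξ)) (mfderiv_extChartAt_self (I := I4) (x := hopf z))
  exact h5.symm.trans h

lemma mfderiv_extChartAt_dhopf {m x : RP2 × RP2} {z : R3 × R3} (hx : x = hopf z)
    (h1 : z.1 (RP2.index m.1) ≠ 0) (h2 : z.2 (RP2.index m.2) ≠ 0) (ξ : R3 × R3) :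
    (mfderiv I4 𝓘(ℝ, R2 × R2) (extChartAt I4 m) x : R2 × R2 →L[ℝ] R2 × R2) (dhopf z ξ) =
      hopfChartDeriv (RP2.index m.1) (RP2.index m.2) z ξ := by
  subst hx
  have hz1 : z.1 ≠ 0 := fun h => h1 (by simp [h])
  have hz2 : z.2 ≠ 0 := fun h => h2 (by simp [h])
  rw [← mfderiv_extChartAt_mfderiv_hopf h1 h2, mfderiv_hopf hz1 hz2]
  rfl

lemma velocity_eq_dhopf {Γ : ℝ → RP2 × RP2} {γ : ℝ → R3 × R3} {γ' : R3 × R3} {t : ℝ}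
    (hΓ : Γ =ᶠ[𝓝 t] hopf ∘ γ) (hγ : HasDerivAt γ γ' t) (h1 : (γ t).1 ≠ 0) (h2 : (γ t).2 ≠ 0) :
    velocity I4 Γ t = dhopf (γ t) γ' := by
  have h3 := hΓ.mfderiv_eq (I := 𝓘(ℝ, ℝ)) (I' := I4)
  have h4 := mfderiv_comp_apply t (mdifferentiableAt_hopf h1 h2)
    (hγ.differentiableAt.mdifferentiableAt) (1 : ℝ)
  have h5 := congrArg (fun A : ℝ →L[ℝ] R2 × R2 => A 1) h3
  refine h5.trans (h4.trans ?_)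
  rw [mfderiv_hopf h1 h2, mfderiv_eq_fderiv]
  exact congrArg (dhopf (γ t)) hγ.deriv

lemma velocity_fst {Γ : ℝ → RP2 × RP2} {t : ℝ} (h : MDifferentiableAt 𝓘(ℝ, ℝ) I4 Γ t) :
    velocity 𝓘(ℝ, R2) (fun s => (Γ s).1) t = (velocity I4 Γ t : R2 × R2).1 := by
  have h1 := mfderiv_comp_apply t (mdifferentiableAt_fst (I := 𝓘(ℝ, R2)) (I' := 𝓘(ℝ, R2))) h
    (1 : ℝ)
  rw [mfderiv_fst] at h1
  exact h1

lemma velocity_snd {Γ : ℝ → RP2 × RP2} {t : ℝ} (h : MDifferentiableAt 𝓘(ℝ, ℝ) I4 Γ t) :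
    velocity 𝓘(ℝ, R2) (fun s => (Γ s).2) t = (velocity I4 Γ t : R2 × R2).2 := by
  have h1 := mfderiv_comp_apply t (mdifferentiableAt_snd (I := 𝓘(ℝ, R2)) (I' := 𝓘(ℝ, R2))) h
    (1 : ℝ)
  rw [mfderiv_snd] at h1
  exact h1

/-! ## The dancing metric in homogeneous and in affine coordinates -/

lemma dotProduct_fin3 (a b : R3) : a ⬝ᵥ b = a 0 * b 0 + a 1 * b 1 + a 2 * b 2 := by
  simp [dotProduct, Fin.sum_univ_three]

lemma mem_Q5_iff {z : R3 × R3} : z ∈ Q5 ↔ z.2 ⬝ᵥ z.1 = 1 := Iff.rfl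

lemma fst_ne_zero_of_mem_Q5 {z : R3 × R3} (h : z ∈ Q5) : z.1 ≠ 0 := fun h0 => by
  rw [mem_Q5_iff, h0, dotProduct_zero] at h
  exact zero_ne_one h

lemma snd_ne_zero_of_mem_Q5 {z : R3 × R3} (h : z ∈ Q5) : z.2 ≠ 0 := fun h0 => by
  rw [mem_Q5_iff, h0, zero_dotProduct] at h
  exact zero_ne_one h

lemma hopf_mem_M4_iff {z : R3 × R3} (h1 : z.1 ≠ 0) (h2 : z.2 ≠ 0) :
    hopf z ∈ M4 ↔ z.2 ⬝ᵥ z.1 ≠ 0 := by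
  obtain ⟨c, hc, h3⟩ := RP2.exists_rep_ofCoords h1
  obtain ⟨d, hd, h4⟩ := RP2.exists_rep_ofCoords h2
  simp [M4, hopf, h3, h4, hc, hd]

lemma hopf_mem_M4 {z : R3 × R3} (h : z ∈ Q5) : hopf z ∈ M4 := by
  rw [hopf_mem_M4_iff (fst_ne_zero_of_mem_Q5 h) (snd_ne_zero_of_mem_Q5 h), mem_Q5_iff.1 h]
  exact one_ne_zero

lemma flatMetric_apply (ξ ζ : R3 × R3) : flatMetric ξ ζ = -(ξ.2 ⬝ᵥ ζ.1 + ζ.2 ⬝ᵥ ξ.1) := rfl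

lemma horizontalPart_apply (z ξ : R3 × R3) :
    horizontalPart z ξ = (ξ.1 - (z.2 ⬝ᵥ ξ.1) • z.1, ξ.2 - (ξ.2 ⬝ᵥ z.1) • z.2) := rfl

lemma flatMetric_horizontalPart {z : R3 × R3} (hz : z ∈ Q5) (ξ ζ : R3 × R3) :
    flatMetric (horizontalPart z ξ) (horizontalPart z ζ) =
      -((ξ.2 ⬝ᵥ ζ.1 - (ξ.2 ⬝ᵥ z.1) * (z.2 ⬝ᵥ ζ.1)) +
        (ζ.2 ⬝ᵥ ξ.1 - (ζ.2 ⬝ᵥ z.1) * (z.2 ⬝ᵥ ξ.1))) := by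
  simp only [flatMetric_apply, horizontalPart_apply, sub_dotProduct, dotProduct_sub,
    smul_dotProduct, dotProduct_smul, smul_eq_mul, mem_Q5_iff.1 hz]
  ring

lemma localSection_hopf {i j : Fin 3} {z : R3 × R3} (h1 : z.1 i ≠ 0) (h2 : z.2 j ≠ 0) :
    localSection i j (hopf z) = ((z.1 i)⁻¹ • z.1, (z.1 i / (z.2 ⬝ᵥ z.1)) • z.2) := by
  have hz1 : z.1 ≠ 0 := fun h => h1 (by simp [h])
  have hz2 : z.2 ≠ 0 := fun h => h2 (by simp [h])
  have ha : (i.insertNth (1 : ℝ) (RP2.affineCoord i (hopf z).1) : R3) = (z.1 i)⁻¹ • z.1 := by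
    rw [← affinePt_homChart h1, hopf, RP2.affineCoord_ofCoords i hz1]
    rfl
  have hb : (j.insertNth (1 : ℝ) (RP2.affineCoord j (hopf z).2) : R3) = (z.2 j)⁻¹ • z.2 := by
    rw [← affinePt_homChart h2, hopf, RP2.affineCoord_ofCoords j hz2]
    rfl
  simp only [localSection, ha, hb, smul_dotProduct, dotProduct_smul, smul_smul, smul_eq_mul]
  congr 2
  by_cases h : z.2 ⬝ᵥ z.1 = 0
  · simp [h]
  · field_simp

lemma contDiffAt_dotProduct {X : Type*} [NormedAddCommGroup X] [NormedSpace ℝ X] {f g : X → R3}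
    {x : X} {n : WithTop ℕ∞} (hf : ContDiffAt ℝ n f x) (hg : ContDiffAt ℝ n g x) :
    ContDiffAt ℝ n (fun x => f x ⬝ᵥ g x) x := by
  simp only [dotProduct_fin3]
  have hf1 := contDiffAt_pi.1 hf
  have hg1 := contDiffAt_pi.1 hg
  exact (((hf1 0).mul (hg1 0)).add ((hf1 1).mul (hg1 1))).add ((hf1 2).mul (hg1 2))

lemma mdifferentiableAt_localSection {i j : Fin 3} {m : RP2 × RP2} (h1 : m.1.rep i ≠ 0)
    (h2 : m.2.rep j ≠ 0) (hm : m ∈ M4) :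
    MDifferentiableAt I4 𝓘(ℝ, R3 × R3) (localSection i j) m := by
  have ha : ContMDiffAt I4 𝓘(ℝ, R2 × R2) ∞
      (fun x : RP2 × RP2 => (RP2.affineCoord i x.1, RP2.affineCoord j x.2)) m :=
    ((RP2.contMDiffAt_affineCoord h1).comp m contMDiffAt_fst).prodMk_space
      ((RP2.contMDiffAt_affineCoord h2).comp m contMDiffAt_snd)
  set y : R2 × R2 := (RP2.affineCoord i m.1, RP2.affineCoord j m.2) with hy
  have hm' : hopf (affinePt i y.1, affinePt j y.2) = m := by
    rw [hopf, RP2.ofCoords_affinePt_affineCoord h1, RP2.ofCoords_affinePt_affineCoord h2]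
  have hF : affinePt j y.2 ⬝ᵥ affinePt i y.1 ≠ 0 := by
    rw [← hm'] at hm
    exact (hopf_mem_M4_iff (affinePt_ne_zero i y.1) (affinePt_ne_zero j y.2)).1 hm
  have hA : ContDiffAt ℝ ∞ (fun y : R2 × R2 => affinePt i y.1) y :=
    ((contDiff_affinePt i).comp contDiff_fst).contDiffAt
  have hB : ContDiffAt ℝ ∞ (fun y : R2 × R2 => affinePt j y.2) y :=
    ((contDiff_affinePt j).comp contDiff_snd).contDiffAt
  have hs : ContDiffAt ℝ ∞ (fun y : R2 × R2 => (affinePt i y.1,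
      (affinePt j y.2 ⬝ᵥ affinePt i y.1)⁻¹ • affinePt j y.2)) y :=
    hA.prodMk (((contDiffAt_dotProduct hB hA).inv hF).smul hB)
  have h : ContMDiffAt I4 𝓘(ℝ, R3 × R3) ∞ (localSection i j) m :=
    ContMDiffAt.comp (I' := 𝓘(ℝ, R2 × R2)) m hs.contMDiffAt ha
  exact h.mdifferentiableAt (by simp)

lemma horizontalPart_rescale {z : R3 × R3} (hz : z ∈ Q5) {c : ℝ} (hc : c ≠ 0) (k l : ℝ)
    (ξ : R3 × R3) :
    horizontalPart (c⁻¹ • z.1, c • z.2) (c⁻¹ • ξ.1 + k • z.1, l • z.2 + c • ξ.2) =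
      (c⁻¹ • (horizontalPart z ξ).1, c • (horizontalPart z ξ).2) := by
  simp only [horizontalPart_apply, add_dotProduct, dotProduct_add,
    smul_dotProduct, dotProduct_smul, smul_eq_mul, mem_Q5_iff.1 hz]
  ext r
  · simp only [Pi.sub_apply, Pi.add_apply, Pi.smul_apply, smul_eq_mul]
    field_simp
    ring
  · simp only [Pi.sub_apply, Pi.add_apply, Pi.smul_apply, smul_eq_mul]
    field_simp
    ring

lemma horizontalLift_dhopf {z : R3 × R3} (hz : z ∈ Q5) (ξ : R3 × R3) :
    horizontalLift (hopf z) (dhopf z ξ) =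
      ((z.1 (RP2.index (hopf z).1))⁻¹ • (horizontalPart z ξ).1,
        z.1 (RP2.index (hopf z).1) • (horizontalPart z ξ).2) := by
  have hz1 := fst_ne_zero_of_mem_Q5 hz
  have hz2 := snd_ne_zero_of_mem_Q5 hz
  obtain ⟨h1, h2⟩ := index_hopf_ne_zero hz1 hz2
  set i := RP2.index (hopf z).1 with hi
  set j := RP2.index (hopf z).2 with hj
  have hbase : basePoint (hopf z) = ((z.1 i)⁻¹ • z.1, z.1 i • z.2) := by
    rw [basePoint, localSection_hopf h1 h2, mem_Q5_iff.1 hz, div_one]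
  have hls : MDifferentiableAt I4 𝓘(ℝ, R3 × R3) (localSection i j) (hopf z) := by
    refine mdifferentiableAt_localSection ?_ ?_ (hopf_mem_M4 hz)
    · exact (RP2.rep_ofCoords_ne_zero_iff hz1 i).2 h1
    · exact (RP2.rep_ofCoords_ne_zero_iff hz2 j).2 h2
  have hchain := mfderiv_comp_apply z hls (mdifferentiableAt_hopf hz1 hz2) ξ
  have hev : localSection i j ∘ hopf =ᶠ[𝓝 z]
      fun w => ((w.1 i)⁻¹ • w.1, (w.1 i / (w.2 ⬝ᵥ w.1)) • w.2) := by
    have e1 : ∀ᶠ w : R3 × R3 in 𝓝 z, w.1 i ≠ 0 :=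
      ((continuous_apply i).comp continuous_fst).continuousAt.eventually_ne h1
    have e2 : ∀ᶠ w : R3 × R3 in 𝓝 z, w.2 j ≠ 0 :=
      ((continuous_apply j).comp continuous_snd).continuousAt.eventually_ne h2
    filter_upwards [e1, e2] with w hw1 hw2
    exact localSection_hopf hw1 hw2
  rw [mfderiv_hopf hz1 hz2, mfderiv_eq_fderiv, hev.fderiv_eq] at hchain
  have hd1 : DifferentiableAt ℝ (fun w : R3 × R3 => (w.1 i)⁻¹) z := by
    have : DifferentiableAt ℝ (fun w : R3 × R3 => w.1 i) z := by fun_prop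
    exact this.inv h1
  have hF : DifferentiableAt ℝ (fun w : R3 × R3 => w.2 ⬝ᵥ w.1) z := by
    simp only [dotProduct_fin3]
    fun_prop
  have hd2 : DifferentiableAt ℝ (fun w : R3 × R3 => w.1 i / (w.2 ⬝ᵥ w.1)) z := by
    have : DifferentiableAt ℝ (fun w : R3 × R3 => w.1 i) z := by fun_prop
    simp only [div_eq_mul_inv]
    refine this.mul (hF.inv ?_)
    rw [mem_Q5_iff.1 hz]
    exact one_ne_zero
  have hder := (hd1.hasFDerivAt.smul hasFDerivAt_fst).prodMk
    (hd2.hasFDerivAt.smul hasFDerivAt_snd)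
  have hval : horizontalLift (hopf z) (dhopf z ξ) = horizontalPart (basePoint (hopf z))
      (fderiv ℝ (fun w : R3 × R3 => ((w.1 i)⁻¹ • w.1, (w.1 i / (w.2 ⬝ᵥ w.1)) • w.2)) z ξ) :=
    congrArg (horizontalPart (basePoint (hopf z))) hchain.symm
  have hD : fderiv ℝ (fun w : R3 × R3 => ((w.1 i)⁻¹ • w.1, (w.1 i / (w.2 ⬝ᵥ w.1)) • w.2)) z ξ =
      ((z.1 i)⁻¹ • ξ.1 + (fderiv ℝ (fun w : R3 × R3 => (w.1 i)⁻¹) z ξ) • z.1,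
        (fderiv ℝ (fun w : R3 × R3 => w.1 i / (w.2 ⬝ᵥ w.1)) z ξ) • z.2 + z.1 i • ξ.2) := by
    refine (congrArg (fun A : R3 × R3 →L[ℝ] R3 × R3 => A ξ) hder.fderiv).trans ?_
    simp [mem_Q5_iff.1 hz, add_comm]
  rw [hval, hbase, hD]
  exact horizontalPart_rescale hz h1 _ _ ξ

lemma dancingMetric_dhopf {z : R3 × R3} (hz : z ∈ Q5) (ξ ζ : R3 × R3) :
    metricAt dancingMetric (hopf z) (dhopf z ξ) (dhopf z ζ) =
      flatMetric (horizontalPart z ξ) (horizontalPart z ζ) := by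
  have h1 := (index_hopf_ne_zero (fst_ne_zero_of_mem_Q5 hz) (snd_ne_zero_of_mem_Q5 hz)).1
  have h : metricAt dancingMetric (hopf z) (dhopf z ξ) (dhopf z ζ) =
      flatMetric (horizontalLift (hopf z) (dhopf z ξ)) (horizontalLift (hopf z) (dhopf z ζ)) := rfl
  rw [h, horizontalLift_dhopf hz, horizontalLift_dhopf hz]
  simp only [flatMetric_apply, smul_dotProduct, dotProduct_smul, smul_eq_mul]
  field_simp

lemma conformalMetric_dhopf (ρ : RP2 × RP2 → ℝ) {z : R3 × R3} (hz : z ∈ Q5) (ξ ζ : R3 × R3) :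
    metricAt (conformalMetric ρ) (hopf z) (dhopf z ξ) (dhopf z ζ) =
      ρ (hopf z) * flatMetric (horizontalPart z ξ) (horizontalPart z ζ) := by
  rw [← dancingMetric_dhopf hz]
  rfl

/-- The homogeneous tangent vector at `z` with affine components `v`. -/
noncomputable def affineLift (i j : Fin 3) (z : R3 × R3) (v : R2 × R2) : R3 × R3 :=
  (z.1 i • insDir i v.1, z.2 j • insDir j v.2)

lemma hopfChartDeriv_affineLift {i j : Fin 3} {z : R3 × R3} (h1 : z.1 i ≠ 0) (h2 : z.2 j ≠ 0)
    (v : R2 × R2) : hopfChartDeriv i j z (affineLift i j z v) = v := by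
  have key : ∀ (i : Fin 3) (q : R3), q i ≠ 0 → ∀ u : R2,
      homChartDeriv i q (q i • insDir i u) = u := fun i q h u => by
    funext k
    simp only [homChartDeriv_apply, Pi.smul_apply, insDir_self, insDir_succAbove, smul_eq_mul]
    field_simp
    ring
  exact Prod.ext (key i z.1 h1 v.1) (key j z.2 h2 v.2)

lemma mfderiv_extChartAt_symm_hopfChart {m : RP2 × RP2} {z : R3 × R3}
    (h1 : z.1 (RP2.index m.1) ≠ 0) (h2 : z.2 (RP2.index m.2) ≠ 0) (v : R2 × R2) :
    (mfderiv 𝓘(ℝ, R2 × R2) I4 (extChartAt I4 m).symm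
      (hopfChart (RP2.index m.1) (RP2.index m.2) z) : R2 × R2 →L[ℝ] R2 × R2) v =
      dhopf z (affineLift (RP2.index m.1) (RP2.index m.2) z v) := by
  have hz1 : z.1 ≠ 0 := fun h => h1 (by simp [h])
  have hz2 : z.2 ≠ 0 := fun h => h2 (by simp [h])
  have hsm : MDifferentiableAt 𝓘(ℝ, R2 × R2) I4 (extChartAt I4 m).symm
      (hopfChart (RP2.index m.1) (RP2.index m.2) z) := by
    have h3 := contMDiffOn_extChartAt_symm (I := I4) (n := ∞) m
    refine (h3.contMDiffAt ?_).mdifferentiableAt (by simp)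
    refine (isOpen_extChartAt_target m).mem_nhds ?_
    rw [← extChartAt_hopf m hz1 hz2]
    exact (extChartAt I4 m).map_source ((hopf_mem_extChartAt_source hz1 hz2).2 ⟨h1, h2⟩)
  have hT := hasFDerivAt_hopfChart h1 h2
  have hchain := mfderiv_comp_apply z hsm hT.differentiableAt.mdifferentiableAt
    (affineLift (RP2.index m.1) (RP2.index m.2) z v)
  have hev : (extChartAt I4 m).symm ∘ hopfChart (RP2.index m.1) (RP2.index m.2) =ᶠ[𝓝 z] hopf := by
    have e1 : ∀ᶠ w : R3 × R3 in 𝓝 z, w.1 (RP2.index m.1) ≠ 0 :=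
      ((continuous_apply _).comp continuous_fst).continuousAt.eventually_ne h1
    have e2 : ∀ᶠ w : R3 × R3 in 𝓝 z, w.2 (RP2.index m.2) ≠ 0 :=
      ((continuous_apply _).comp continuous_snd).continuousAt.eventually_ne h2
    filter_upwards [e1, e2] with w hw1 hw2
    have hne1 : w.1 ≠ 0 := fun h => hw1 (by simp [h])
    have hne2 : w.2 ≠ 0 := fun h => hw2 (by simp [h])
    rw [Function.comp_apply, ← extChartAt_hopf m hne1 hne2]
    exact (extChartAt I4 m).left_inv ((hopf_mem_extChartAt_source hne1 hne2).2 ⟨hw1, hw2⟩)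
  have h5 := congrArg (fun A : R3 × R3 →L[ℝ] R2 × R2 =>
    A (affineLift (RP2.index m.1) (RP2.index m.2) z v))
    (hev.mfderiv_eq (I := 𝓘(ℝ, R3 × R3)) (I' := I4))
  rw [mfderiv_hopf hz1 hz2] at h5
  rw [mfderiv_eq_fderiv, hT.fderiv] at hchain
  have h6 := hopfChartDeriv_affineLift h1 h2 v
  refine Eq.trans ?_ (hchain.symm.trans h5)
  exact congrArg (mfderiv 𝓘(ℝ, R2 × R2) I4 (extChartAt I4 m).symm
      (hopfChart (RP2.index m.1) (RP2.index m.2) z) : R2 × R2 →L[ℝ] R2 × R2) h6.symm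

lemma localMetric_hopfChart (ρ : RP2 × RP2 → ℝ) {m : RP2 × RP2} {z : R3 × R3} (hz : z ∈ Q5)
    (h1 : z.1 (RP2.index m.1) ≠ 0) (h2 : z.2 (RP2.index m.2) ≠ 0) (v w : R2 × R2) :
    localMetric I4 (conformalMetric ρ) m (hopfChart (RP2.index m.1) (RP2.index m.2) z) v w =
      ρ (hopf z) * flatMetric
        (horizontalPart z (affineLift (RP2.index m.1) (RP2.index m.2) z v))
        (horizontalPart z (affineLift (RP2.index m.1) (RP2.index m.2) z w)) := by
  have hz1 := fst_ne_zero_of_mem_Q5 hz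
  have hz2 := snd_ne_zero_of_mem_Q5 hz
  have hs : (extChartAt I4 m).symm (hopfChart (RP2.index m.1) (RP2.index m.2) z) = hopf z := by
    rw [← extChartAt_hopf m hz1 hz2]
    exact (extChartAt I4 m).left_inv ((hopf_mem_extChartAt_source hz1 hz2).2 ⟨h1, h2⟩)
  rw [← conformalMetric_dhopf ρ hz, ← mfderiv_extChartAt_symm_hopfChart h1 h2,
    ← mfderiv_extChartAt_symm_hopfChart h1 h2, ← hs]
  rfl

/-! ## The Christoffel symbols -/

lemma fderiv_clm_apply_apply {E : Type*} [NormedAddCommGroup E] [NormedSpace ℝ E]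
    {G : E → E →L[ℝ] E →L[ℝ] ℝ} {y : E} (hG : DifferentiableAt ℝ G y) (u v w : E) :
    fderiv ℝ G y u v w = fderiv ℝ (fun y => G y v w) y u := by
  have h := (hG.hasFDerivAt.clm_apply (hasFDerivAt_const v y)).clm_apply (hasFDerivAt_const w y)
  rw [h.fderiv]
  simp

lemma finrank_continuous_dual {E : Type*} [NormedAddCommGroup E] [NormedSpace ℝ E]
    [FiniteDimensional ℝ E] : finrank ℝ (E →L[ℝ] ℝ) = finrank ℝ E := by
  rw [← Subspace.dual_finrank_eq (K := ℝ) (V := E)]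
  exact (LinearMap.toContinuousLinearMap (𝕜 := ℝ) (E := E) (F' := ℝ)).finrank_eq.symm

/-- The Christoffel symbols of a nondegenerate metric are characterized by Koszul's formula. -/
lemma christoffel_eq {E : Type*} [NormedAddCommGroup E] [NormedSpace ℝ E]
    [FiniteDimensional ℝ E] {G : E → E →L[ℝ] E →L[ℝ] ℝ} {y : E} (hG : DifferentiableAt ℝ G y)
    (hnd : ∀ v, (∀ w, G y v w = 0) → v = 0) {v w x : E}
    (h : ∀ u, G y x u = (1 / 2 : ℝ) * (fderiv ℝ (fun y => G y w u) y v +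
      fderiv ℝ (fun y => G y v u) y w - fderiv ℝ (fun y => G y v w) y u)) :
    christoffel G y v w = x := by
  have hinj : Function.Injective (G y).toLinearMap := by
    rw [← LinearMap.ker_eq_bot, LinearMap.ker_eq_bot']
    intro v hv
    refine hnd v fun w => ?_
    have : G y v = 0 := hv
    rw [this]
    rfl
  have hinv : (G y).IsInvertible :=
    ⟨((G y).toLinearMap.linearEquivOfInjective hinj
      finrank_continuous_dual.symm).toContinuousLinearEquiv, by ext; rfl⟩
  rw [christoffel, hinv.inverse_apply_eq]
  refine ContinuousLinearMap.ext fun u => ?_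
  rw [h u, ← fderiv_clm_apply_apply hG, ← fderiv_clm_apply_apply hG,
    ← fderiv_clm_apply_apply hG]
  rfl

/-- The pairing `⟨b, a⟩` of the homogeneous coordinates with affine coordinates `y`. -/
noncomputable def affinePairing (i j : Fin 3) (y : R2 × R2) : ℝ :=
  affinePt j y.2 ⬝ᵥ affinePt i y.1

/-- One half of the dancing metric in affine coordinates. -/
noncomputable def dancingHalf (i j : Fin 3) (y v w : R2 × R2) : ℝ :=
  (affinePairing i j y)⁻¹ * (insDir j v.2 ⬝ᵥ insDir i w.1) -
    (affinePairing i j y)⁻¹ ^ 2 *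
      ((insDir j v.2 ⬝ᵥ affinePt i y.1) * (affinePt j y.2 ⬝ᵥ insDir i w.1))

/-- The dancing metric in affine coordinates. -/
noncomputable def dancingCoord (i j : Fin 3) (y v w : R2 × R2) : ℝ :=
  -(dancingHalf i j y v w + dancingHalf i j y w v)

/-- The derivative of `dancingHalf` with respect to `y`, in the direction `u`. -/
noncomputable def dancingHalfDeriv (i j : Fin 3) (y u v w : R2 × R2) : ℝ :=
  let F := affinePairing i j y
  let F' := insDir j u.2 ⬝ᵥ affinePt i y.1 + affinePt j y.2 ⬝ᵥ insDir i u.1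
  2 * F' / F ^ 3 * ((insDir j v.2 ⬝ᵥ affinePt i y.1) * (affinePt j y.2 ⬝ᵥ insDir i w.1)) -
    F' / F ^ 2 * (insDir j v.2 ⬝ᵥ insDir i w.1) -
    F⁻¹ ^ 2 * ((insDir j v.2 ⬝ᵥ insDir i u.1) * (affinePt j y.2 ⬝ᵥ insDir i w.1) +
      (insDir j v.2 ⬝ᵥ affinePt i y.1) * (insDir j u.2 ⬝ᵥ insDir i w.1))

lemma affinePt_add_smul (i : Fin 3) (y u : R2) (s : ℝ) :
    affinePt i (y + s • u) = affinePt i y + s • insDir i u := by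
  rw [affinePt_add, map_smul]

lemma contDiff_affinePairing (i j : Fin 3) : ContDiff ℝ ∞ (affinePairing i j) :=
  contDiff_iff_contDiffAt.2 fun _ => contDiffAt_dotProduct
    ((contDiff_affinePt j).comp contDiff_snd).contDiffAt
    ((contDiff_affinePt i).comp contDiff_fst).contDiffAt

lemma contDiffAt_dancingHalf {i j : Fin 3} {y : R2 × R2} (hF : affinePairing i j y ≠ 0)
    (v w : R2 × R2) : ContDiffAt ℝ ∞ (fun y => dancingHalf i j y v w) y := by
  have h1 := ((contDiff_affinePairing i j).contDiffAt (x := y)).inv hF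
  have h2 : ContDiffAt ℝ ∞ (fun y : R2 × R2 => insDir j v.2 ⬝ᵥ affinePt i y.1) y :=
    contDiffAt_dotProduct contDiffAt_const ((contDiff_affinePt i).comp contDiff_fst).contDiffAt
  have h3 : ContDiffAt ℝ ∞ (fun y : R2 × R2 => affinePt j y.2 ⬝ᵥ insDir i w.1) y :=
    contDiffAt_dotProduct ((contDiff_affinePt j).comp contDiff_snd).contDiffAt contDiffAt_const
  exact (h1.mul contDiffAt_const).sub ((h1.pow 2).mul (h2.mul h3))

lemma contDiffAt_dancingCoord {i j : Fin 3} {y : R2 × R2} (hF : affinePairing i j y ≠ 0)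
    (v w : R2 × R2) : ContDiffAt ℝ ∞ (fun y => dancingCoord i j y v w) y :=
  ((contDiffAt_dancingHalf hF v w).add (contDiffAt_dancingHalf hF w v)).neg

lemma fderiv_dancingHalf {i j : Fin 3} {y : R2 × R2} (hF : affinePairing i j y ≠ 0)
    (u v w : R2 × R2) :
    fderiv ℝ (fun y => dancingHalf i j y v w) y u = dancingHalfDeriv i j y u v w := by
  rw [← ((contDiffAt_dancingHalf hF v w).differentiableAt (by simp)).lineDeriv_eq_fderiv, lineDeriv]
  have hlin : ∀ c d : ℝ, HasDerivAt (fun s : ℝ => c + s * d) d 0 := fun c d => by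
    simpa using ((hasDerivAt_id (0 : ℝ)).mul_const d).const_add c
  have hP : HasDerivAt (fun s : ℝ => affinePairing i j (y + s • u))
      (insDir j u.2 ⬝ᵥ affinePt i y.1 + affinePt j y.2 ⬝ᵥ insDir i u.1) 0 := by
    have : (fun s : ℝ => affinePairing i j (y + s • u)) = fun s =>
        (affinePairing i j y +
          s * (insDir j u.2 ⬝ᵥ affinePt i y.1 + affinePt j y.2 ⬝ᵥ insDir i u.1)) +
          s ^ 2 * (insDir j u.2 ⬝ᵥ insDir i u.1) := by
      funext s
      simp only [affinePairing, Prod.fst_add, Prod.snd_add, Prod.smul_fst, Prod.smul_snd,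
        affinePt_add_smul, add_dotProduct, dotProduct_add, smul_dotProduct, dotProduct_smul,
        smul_eq_mul]
      ring
    rw [this]
    refine ((hlin _ _).add (((hasDerivAt_id (0 : ℝ)).fun_pow 2).mul_const
      (insDir j u.2 ⬝ᵥ insDir i u.1))).congr_deriv ?_
    simp
  have hA : HasDerivAt (fun s : ℝ => insDir j v.2 ⬝ᵥ affinePt i (y + s • u).1)
      (insDir j v.2 ⬝ᵥ insDir i u.1) 0 := by
    simpa only [Prod.fst_add, Prod.smul_fst, affinePt_add_smul, dotProduct_add, dotProduct_smul,
      smul_eq_mul] using hlin _ _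
  have hB : HasDerivAt (fun s : ℝ => affinePt j (y + s • u).2 ⬝ᵥ insDir i w.1)
      (insDir j u.2 ⬝ᵥ insDir i w.1) 0 := by
    simpa only [Prod.snd_add, Prod.smul_snd, affinePt_add_smul, add_dotProduct, smul_dotProduct,
      smul_eq_mul] using hlin _ _
  have hF0 : affinePairing i j (y + (0 : ℝ) • u) ≠ 0 := by simpa using hF
  have h := ((hP.fun_inv hF0).mul_const (insDir j v.2 ⬝ᵥ insDir i w.1)).sub
    (((hP.fun_inv hF0).fun_pow 2).mul (hA.mul hB))
  refine h.deriv.trans ?_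
  simp only [zero_smul, add_zero, dancingHalfDeriv, Pi.mul_apply, Nat.reduceSub, pow_one,
    Nat.cast_ofNat]
  field_simp
  ring

lemma fderiv_dancingCoord {i j : Fin 3} {y : R2 × R2} (hF : affinePairing i j y ≠ 0)
    (u v w : R2 × R2) :
    fderiv ℝ (fun y => dancingCoord i j y v w) y u =
      -(dancingHalfDeriv i j y u v w + dancingHalfDeriv i j y u w v) := by
  rw [← fderiv_dancingHalf hF, ← fderiv_dancingHalf hF]
  have h1 := ((contDiffAt_dancingHalf hF v w).differentiableAt (by simp)).hasFDerivAt
  have h2 := ((contDiffAt_dancingHalf hF w v).differentiableAt (by simp)).hasFDerivAt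
  have h := (h1.add h2).neg.fderiv
  exact congrArg (fun A : R2 × R2 →L[ℝ] ℝ => A u) h

/-- The Christoffel symbols of the dancing metric. -/
noncomputable def dancingConn (i j : Fin 3) (y v w : R2 × R2) : R2 × R2 :=
  (projConn i (affinePt i y.1) (affinePt j y.2) v.1 w.1,
    projConn j (affinePt j y.2) (affinePt i y.1) v.2 w.2)

lemma dancingCoord_dancingConn {i j : Fin 3} {y : R2 × R2} (hF : affinePairing i j y ≠ 0)
    (u v w : R2 × R2) :
    dancingCoord i j y (dancingConn i j y v w) u = (1 / 2 : ℝ) *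
      (fderiv ℝ (fun y => dancingCoord i j y w u) y v +
        fderiv ℝ (fun y => dancingCoord i j y v u) y w -
        fderiv ℝ (fun y => dancingCoord i j y v w) y u) := by
  rw [fderiv_dancingCoord hF, fderiv_dancingCoord hF, fderiv_dancingCoord hF]
  have hF' : affinePt j y.2 ⬝ᵥ affinePt i y.1 ≠ 0 := hF
  simp only [dancingCoord, dancingHalf, dancingHalfDeriv, dancingConn, projConn, map_neg, map_add,
    map_smul, neg_dotProduct, dotProduct_neg, add_dotProduct, dotProduct_add, smul_dotProduct,
    dotProduct_smul, smul_eq_mul, affinePairing,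
    dotProduct_comm (affinePt i y.1) (insDir j _), dotProduct_comm (affinePt i y.1) (affinePt j _)]
  field_simp
  ring

lemma dancingCoord_add_left (i j : Fin 3) (y v w u : R2 × R2) :
    dancingCoord i j y (v + w) u = dancingCoord i j y v u + dancingCoord i j y w u := by
  simp only [dancingCoord, dancingHalf, Prod.fst_add, Prod.snd_add, map_add, add_dotProduct,
    dotProduct_add]
  ring

lemma dancingCoord_smul_left (i j : Fin 3) (y v u : R2 × R2) (c : ℝ) :
    dancingCoord i j y (c • v) u = c * dancingCoord i j y v u := by
  simp only [dancingCoord, dancingHalf, Prod.smul_fst, Prod.smul_snd, map_smul, smul_dotProduct,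
    dotProduct_smul, smul_eq_mul]
  ring

/-- The lift to `Q⁵` of the point with affine coordinates `y`. -/
noncomputable def affineSection (i j : Fin 3) (y : R2 × R2) : R3 × R3 :=
  (affinePt i y.1, (affinePairing i j y)⁻¹ • affinePt j y.2)

lemma affineSection_mem_Q5 {i j : Fin 3} {y : R2 × R2} (hF : affinePairing i j y ≠ 0) :
    affineSection i j y ∈ Q5 := by
  rw [mem_Q5_iff, affineSection, smul_dotProduct]
  exact inv_mul_cancel₀ hF

lemma hopfChart_affineSection {i j : Fin 3} {y : R2 × R2} (hF : affinePairing i j y ≠ 0) :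
    hopfChart i j (affineSection i j y) = y := by
  rw [hopfChart, affineSection, homChart_smul _ _ (inv_ne_zero hF), homChart_affinePt,
    homChart_affinePt]

lemma hopf_affineSection {m : RP2 × RP2} {y : R2 × R2}
    (hF : affinePairing (RP2.index m.1) (RP2.index m.2) y ≠ 0) :
    hopf (affineSection (RP2.index m.1) (RP2.index m.2) y) = (extChartAt I4 m).symm y := by
  rw [extChartAt_symm_apply_I4, hopf, affineSection,
    RP2.ofCoords_smul (inv_ne_zero hF) (affinePt_ne_zero _ _), hopf]

lemma flatMetric_affineSection {i j : Fin 3} {y : R2 × R2} (hF : affinePairing i j y ≠ 0)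
    (v w : R2 × R2) :
    flatMetric (horizontalPart (affineSection i j y) (affineLift i j (affineSection i j y) v))
        (horizontalPart (affineSection i j y) (affineLift i j (affineSection i j y) w)) =
      dancingCoord i j y v w := by
  rw [flatMetric_horizontalPart (affineSection_mem_Q5 hF)]
  simp only [affineSection, affineLift, dancingCoord, dancingHalf, smul_dotProduct,
    dotProduct_smul, smul_eq_mul, Pi.smul_apply, affinePt_self]
  ring

lemma localMetric_eq (ρ : RP2 × RP2 → ℝ) (m : RP2 × RP2) {y : R2 × R2}
    (hF : affinePairing (RP2.index m.1) (RP2.index m.2) y ≠ 0) (v w : R2 × R2) :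
    localMetric I4 (conformalMetric ρ) m y v w =
      ρ ((extChartAt I4 m).symm y) *
        dancingCoord (RP2.index m.1) (RP2.index m.2) y v w := by
  have h1 : (affineSection (RP2.index m.1) (RP2.index m.2) y).1 (RP2.index m.1) ≠ 0 := by
    simp [affineSection]
  have h2 : (affineSection (RP2.index m.1) (RP2.index m.2) y).2 (RP2.index m.2) ≠ 0 := by
    simp [affineSection, hF]
  have h := localMetric_hopfChart ρ (affineSection_mem_Q5 hF) h1 h2 v w
  rw [hopfChart_affineSection hF, flatMetric_affineSection hF, hopf_affineSection hF] at h
  exact h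

lemma horizontalPart_idem {z : R3 × R3} (hz : z ∈ Q5) (ξ : R3 × R3) :
    z.2 ⬝ᵥ (horizontalPart z ξ).1 = 0 ∧ (horizontalPart z ξ).2 ⬝ᵥ z.1 = 0 := by
  simp [horizontalPart_apply, dotProduct_sub, sub_dotProduct, mem_Q5_iff.1 hz]

lemma eq_zero_of_dotProduct_self_eq_zero {a : R3} (h : a ⬝ᵥ a = 0) : a = 0 :=
  dotProduct_self_eq_zero.1 h

lemma hopfChartDeriv_fiber {i j : Fin 3} {z : R3 × R3} (h1 : z.1 i ≠ 0) (h2 : z.2 j ≠ 0)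
    (c d : ℝ) : hopfChartDeriv i j z (c • z.1, d • z.2) = 0 := by
  refine Prod.ext ?_ ?_
  · exact (map_smul (homChartDeriv i z.1) c z.1).trans
      ((congrArg (c • ·) (homChartDeriv_self h1)).trans (smul_zero c))
  · exact (map_smul (homChartDeriv j z.2) d z.2).trans
      ((congrArg (d • ·) (homChartDeriv_self h2)).trans (smul_zero d))

lemma hopfChartDeriv_horizontalPart {i j : Fin 3} {z : R3 × R3} (h1 : z.1 i ≠ 0) (h2 : z.2 j ≠ 0)
    (ξ : R3 × R3) : hopfChartDeriv i j z (horizontalPart z ξ) = hopfChartDeriv i j z ξ := by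
  have h : horizontalPart z ξ = ξ - ((z.2 ⬝ᵥ ξ.1) • z.1, (ξ.2 ⬝ᵥ z.1) • z.2) := rfl
  rw [h, map_sub, hopfChartDeriv_fiber h1 h2, sub_zero]

lemma horizontalPart_eq_of_hopfChartDeriv_eq {i j : Fin 3} {z : R3 × R3} (hz : z ∈ Q5)
    (h1 : z.1 i ≠ 0) (h2 : z.2 j ≠ 0) {ξ ζ : R3 × R3}
    (h : hopfChartDeriv i j z ξ = hopfChartDeriv i j z ζ) :
    horizontalPart z ξ = horizontalPart z ζ := by
  have h0 : hopfChartDeriv i j z (ξ - ζ) = 0 := by rw [map_sub, h, sub_self]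
  obtain ⟨c, e1⟩ : ∃ c : ℝ, (ξ - ζ).1 = c • z.1 :=
    ⟨_, homChartDeriv_eq_zero h1 (congrArg Prod.fst h0)⟩
  obtain ⟨d, e2⟩ : ∃ d : ℝ, (ξ - ζ).2 = d • z.2 :=
    ⟨_, homChartDeriv_eq_zero h2 (congrArg Prod.snd h0)⟩
  rw [← sub_eq_zero, ← map_sub, horizontalPart_apply, e1, e2]
  simp [mem_Q5_iff.1 hz]

lemma dancingCoord_nondegenerate {i j : Fin 3} {y : R2 × R2} (hF : affinePairing i j y ≠ 0)
    {v : R2 × R2} (h : ∀ w, dancingCoord i j y v w = 0) : v = 0 := by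
  set z := affineSection i j y with hz
  have hzQ : z ∈ Q5 := affineSection_mem_Q5 hF
  have h1 : z.1 i ≠ 0 := by simp [hz, affineSection]
  have h2 : z.2 j ≠ 0 := by simp [hz, affineSection, hF]
  set ξ := horizontalPart z (affineLift i j z v) with hξ
  obtain ⟨e1, e2⟩ := horizontalPart_idem hzQ (affineLift i j z v)
  have key : ∀ ζ : R3 × R3, flatMetric ξ (horizontalPart z ζ) = 0 := fun ζ => by
    have h3 := h (hopfChartDeriv i j z ζ)
    rw [← flatMetric_affineSection hF] at h3
    rwa [horizontalPart_eq_of_hopfChartDeriv_eq (ζ := ζ) hzQ h1 h2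
      (hopfChartDeriv_affineLift h1 h2 _)] at h3
  have k1 : ξ.1 = 0 := by
    refine eq_zero_of_dotProduct_self_eq_zero ?_
    have := key (0, ξ.1)
    simp only [flatMetric_apply, horizontalPart_apply, sub_dotProduct, smul_dotProduct,
      dotProduct_sub, dotProduct_smul, smul_eq_mul, dotProduct_zero] at this
    rw [e1] at this
    linarith
  have k2 : ξ.2 = 0 := by
    refine eq_zero_of_dotProduct_self_eq_zero ?_
    have := key (ξ.2, 0)
    simp only [flatMetric_apply, horizontalPart_apply, sub_dotProduct, smul_dotProduct,
      dotProduct_sub, dotProduct_smul, smul_eq_mul, zero_dotProduct] at this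
    rw [e2] at this
    linarith
  have k3 : ξ = 0 := Prod.ext k1 k2
  rw [← hopfChartDeriv_affineLift h1 h2 v, ← hopfChartDeriv_horizontalPart h1 h2, ← hξ, k3,
    map_zero]

lemma contDiffOn_conformalFactor {ρ : RP2 × RP2 → ℝ} (hρ : ContMDiffOn I4 𝓘(ℝ, ℝ) ∞ ρ M4)
    (m : RP2 × RP2) :
    ContDiffOn ℝ ∞ (fun y => ρ ((extChartAt I4 m).symm y))
      {y | affinePairing (RP2.index m.1) (RP2.index m.2) y ≠ 0} := by
  rw [← contMDiffOn_iff_contDiffOn]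
  refine hρ.comp ((contMDiffOn_extChartAt_symm (I := I4) (n := ∞) m).mono ?_) ?_
  · intro y hy
    have h1 : (affineSection (RP2.index m.1) (RP2.index m.2) y).1 (RP2.index m.1) ≠ 0 := by
      simp [affineSection]
    have h2 : (affineSection (RP2.index m.1) (RP2.index m.2) y).2 (RP2.index m.2) ≠ 0 := by
      simpa [affineSection] using hy
    have hQ := affineSection_mem_Q5 hy
    rw [← hopfChart_affineSection hy, ← extChartAt_hopf m (fst_ne_zero_of_mem_Q5 hQ)
      (snd_ne_zero_of_mem_Q5 hQ)]
    exact (extChartAt I4 m).map_source ((hopf_mem_extChartAt_source (fst_ne_zero_of_mem_Q5 hQ)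
      (snd_ne_zero_of_mem_Q5 hQ)).2 ⟨h1, h2⟩)
  · intro y hy
    rw [mem_preimage, ← hopf_affineSection hy]
    exact hopf_mem_M4 (affineSection_mem_Q5 hy)

/-- The Christoffel symbols of a metric conformal to the dancing metric, on orthogonal vectors. -/
lemma christoffel_conformalMetric {ρ : RP2 × RP2 → ℝ} (hρ : ContMDiffOn I4 𝓘(ℝ, ℝ) ∞ ρ M4)
    (hρ_pos : ∀ m ∈ M4, 0 < ρ m) (m : RP2 × RP2) {y : R2 × R2}
    (hF : affinePairing (RP2.index m.1) (RP2.index m.2) y ≠ 0) {v w : R2 × R2}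
    (hvw : dancingCoord (RP2.index m.1) (RP2.index m.2) y v w = 0) :
    ∃ k l : ℝ, christoffel (localMetric I4 (conformalMetric ρ) m) y v w =
      dancingConn (RP2.index m.1) (RP2.index m.2) y v w + (k • v + l • w) := by
  set i := RP2.index m.1
  set j := RP2.index m.2
  set R : R2 × R2 → ℝ := fun y => ρ ((extChartAt I4 m).symm y) with hR
  set G := localMetric I4 (conformalMetric ρ) m with hG
  set U : Set (R2 × R2) := {y | affinePairing i j y ≠ 0} with hU
  have hUo : IsOpen U := isOpen_ne_fun (contDiff_affinePairing i j).continuous continuous_const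
  have hUy : U ∈ 𝓝 y := hUo.mem_nhds hF
  have hRU : ContDiffOn ℝ ∞ R U := contDiffOn_conformalFactor hρ m
  have hGU : ContDiffOn ℝ ∞ G U := by
    rw [contDiffOn_clm_apply]
    intro v
    rw [contDiffOn_clm_apply]
    intro w
    refine ContDiffOn.congr (f := fun y => R y * dancingCoord i j y v w) ?_ ?_
    · exact hRU.mul fun y hy => (contDiffAt_dancingCoord hy v w).contDiffWithinAt
    · exact fun y hy => localMetric_eq ρ m hy v w
  have hGd : DifferentiableAt ℝ G y := (hGU.contDiffAt hUy).differentiableAt (by simp)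
  have hRd := ((hRU.contDiffAt hUy).differentiableAt (by simp)).hasFDerivAt
  have hRpos : 0 < R y := by
    refine hρ_pos _ ?_
    rw [← hopf_affineSection hF]
    exact hopf_mem_M4 (affineSection_mem_Q5 hF)
  have hder : ∀ u v w, fderiv ℝ (fun y => G y v w) y u =
      R y * fderiv ℝ (fun y => dancingCoord i j y v w) y u +
        dancingCoord i j y v w * fderiv ℝ R y u := fun u v w => by
    have hev : (fun y => G y v w) =ᶠ[𝓝 y] fun y => R y * dancingCoord i j y v w := by
      filter_upwards [hUy] with y hy
      exact localMetric_eq ρ m hy v w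
    have h2 := ((contDiffAt_dancingCoord hF v w).differentiableAt (by simp)).hasFDerivAt
    rw [hev.fderiv_eq, (hRd.fun_mul h2).fderiv]
    rfl
  have hGe : ∀ v w, G y v w = R y * dancingCoord i j y v w := localMetric_eq ρ m hF
  refine ⟨fderiv ℝ R y w / (2 * R y), fderiv ℝ R y v / (2 * R y), ?_⟩
  refine christoffel_eq hGd (fun v hv => dancingCoord_nondegenerate hF fun w => ?_) fun u => ?_
  · have := hv w
    rw [hGe] at this
    exact (mul_eq_zero.1 this).resolve_left hRpos.ne'
  · rw [hder, hder, hder, hvw, hGe, dancingCoord_add_left, dancingCoord_add_left,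
      dancingCoord_smul_left, dancingCoord_smul_left, dancingCoord_dancingConn hF]
    field_simp
    ring

/-! ## Vector fields along curves, in homogeneous coordinates -/

lemma affinePairing_hopfChart {i j : Fin 3} {z : R3 × R3} (hz : z ∈ Q5) (h1 : z.1 i ≠ 0)
    (h2 : z.2 j ≠ 0) : affinePairing i j (hopfChart i j z) ≠ 0 := by
  rw [affinePairing, hopfChart, affinePt_homChart h1, affinePt_homChart h2, smul_dotProduct,
    dotProduct_smul, mem_Q5_iff.1 hz]
  simp [h1, h2]

lemma dancingCoord_hopfChart {m : RP2 × RP2} {z : R3 × R3} (hz : z ∈ Q5)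
    (h1 : z.1 (RP2.index m.1) ≠ 0) (h2 : z.2 (RP2.index m.2) ≠ 0) (ξ ζ : R3 × R3) :
    dancingCoord (RP2.index m.1) (RP2.index m.2) (hopfChart (RP2.index m.1) (RP2.index m.2) z)
      (hopfChartDeriv (RP2.index m.1) (RP2.index m.2) z ξ)
      (hopfChartDeriv (RP2.index m.1) (RP2.index m.2) z ζ) =
      flatMetric (horizontalPart z ξ) (horizontalPart z ζ) := by
  have h := localMetric_hopfChart (fun _ => 1) hz h1 h2
    (hopfChartDeriv (RP2.index m.1) (RP2.index m.2) z ξ)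
    (hopfChartDeriv (RP2.index m.1) (RP2.index m.2) z ζ)
  rw [localMetric_eq _ _ (affinePairing_hopfChart hz h1 h2), one_mul, one_mul] at h
  rw [h, horizontalPart_eq_of_hopfChartDeriv_eq hz h1 h2 (hopfChartDeriv_affineLift h1 h2 _),
    horizontalPart_eq_of_hopfChartDeriv_eq hz h1 h2 (hopfChartDeriv_affineLift h1 h2 _)]

lemma eventually_coord_ne_zero {γ : ℝ → R3 × R3} {t : ℝ} (hγ : ContinuousAt γ t) {i j : Fin 3}
    (h1 : (γ t).1 i ≠ 0) (h2 : (γ t).2 j ≠ 0) :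
    ∀ᶠ s in 𝓝 t, (γ s).1 i ≠ 0 ∧ (γ s).2 j ≠ 0 := by
  have e1 : ContinuousAt (fun s => (γ s).1 i) t := by fun_prop
  have e2 : ContinuousAt (fun s => (γ s).2 j) t := by fun_prop
  exact (e1.eventually_ne h1).and (e2.eventually_ne h2)

/-- The covariant derivative, for a metric conformal to the dancing metric, of a vector field
orthogonal to a curve, in terms of homogeneous coordinates. -/
lemma covariantDeriv_eq_dhopf {ρ : RP2 × RP2 → ℝ} (hρ : ContMDiffOn I4 𝓘(ℝ, ℝ) ∞ ρ M4)
    (hρ_pos : ∀ m ∈ M4, 0 < ρ m) {Γ : ℝ → RP2 × RP2} {γ ξ : ℝ → R3 × R3} {γ' ξ' : R3 × R3}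
    {t : ℝ} (V : ∀ t, TangentSpace I4 (Γ t)) (hΓ : Γ =ᶠ[𝓝 t] hopf ∘ γ)
    (hγ : HasDerivAt γ γ' t) (hξ : HasDerivAt ξ ξ' t)
    (hV : ∀ᶠ s in 𝓝 t, (V s : R2 × R2) = dhopf (γ s) (ξ s)) (hQ : γ t ∈ Q5)
    (hγ' : γ'.2 ⬝ᵥ (γ t).1 + (γ t).2 ⬝ᵥ γ'.1 = 0) (hξ1 : (γ t).2 ⬝ᵥ (ξ t).1 = 0)
    (hξ2 : (ξ t).2 ⬝ᵥ (γ t).1 = 0)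
    (hnull : flatMetric (horizontalPart (γ t) γ') (horizontalPart (γ t) (ξ t)) = 0) :
    ∃ k l : ℝ, (covariantDeriv I4 (conformalMetric ρ) Γ V t : R2 × R2) =
      dhopf (γ t) (ξ'.1 - ((γ t).2 ⬝ᵥ γ'.1) • (ξ t).1, ξ'.2 + ((γ t).2 ⬝ᵥ γ'.1) • (ξ t).2) +
        (k • dhopf (γ t) γ' + l • dhopf (γ t) (ξ t)) := by
  have hm : Γ t = hopf (γ t) := hΓ.eq_of_nhds
  obtain ⟨h1, h2⟩ := index_hopf_ne_zero (fst_ne_zero_of_mem_Q5 hQ) (snd_ne_zero_of_mem_Q5 hQ)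
  have hT : dhopf (γ t) = hopfChartDeriv (RP2.index (Γ t).1) (RP2.index (Γ t).2) (γ t) := by
    rw [hm]
    rfl
  rw [← hm] at h1 h2
  rw [hT]
  set m := Γ t with hmdef
  set i := RP2.index m.1 with hi
  set j := RP2.index m.2 with hj
  have hne := eventually_coord_ne_zero hγ.continuousAt h1 h2
  set x : ℝ → R2 × R2 := fun s => extChartAt I4 m (Γ s) with hx
  set v : ℝ → R2 × R2 := localVectorField I4 Γ V m with hv
  have hxe : x =ᶠ[𝓝 t] fun s => hopfChart i j (γ s) := by
    filter_upwards [hΓ, hne] with s hs hs'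
    have e1 : (γ s).1 ≠ 0 := fun h => hs'.1 (by simp [h])
    have e2 : (γ s).2 ≠ 0 := fun h => hs'.2 (by simp [h])
    rw [hx]
    simp only [hs, Function.comp_apply]
    exact extChartAt_hopf m e1 e2
  have hve : v =ᶠ[𝓝 t] fun s => hopfChartDeriv i j (γ s) (ξ s) := by
    filter_upwards [hΓ, hne, hV] with s hs hs' hVs
    refine Eq.trans ?_ (mfderiv_extChartAt_dhopf hs hs'.1 hs'.2 (ξ s))
    exact congrArg (mfderiv I4 𝓘(ℝ, R2 × R2) (extChartAt I4 m) (Γ s) :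
      R2 × R2 →L[ℝ] R2 × R2) hVs
  have hxd : HasDerivAt x (hopfChartDeriv i j (γ t) γ') t :=
    ((hasFDerivAt_hopfChart h1 h2).comp_hasDerivAt t hγ).congr_of_eventuallyEq hxe
  have hvd := (((hasDerivAt_homChartDeriv hγ.fst hξ.fst h1).prodMk
    (hasDerivAt_homChartDeriv hγ.snd hξ.snd h2)).congr_of_eventuallyEq hve)
  have hF := affinePairing_hopfChart hQ h1 h2
  obtain ⟨k, l, hkl⟩ := christoffel_conformalMetric hρ hρ_pos m hF
    (v := hopfChartDeriv i j (γ t) γ') (w := hopfChartDeriv i j (γ t) (ξ t))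
    (by rw [dancingCoord_hopfChart hQ h1 h2, hnull])
  refine ⟨k, l, ?_⟩
  have hcov : (covariantDeriv I4 (conformalMetric ρ) Γ V t : R2 × R2) =
      deriv v t + christoffel (localMetric I4 (conformalMetric ρ) m) (x t) (deriv x t) (v t) := rfl
  rw [hcov, hvd.deriv, hxd.deriv, hve.eq_of_nhds, hxe.eq_of_nhds, hkl, ← add_assoc]
  congr 1
  refine Prod.ext ?_ ?_
  · have e := homChartDeriv_covariant (α' := ξ'.1) (q' := γ'.1) h1 (mem_Q5_iff.1 hQ) hξ1
    refine Eq.trans ?_ e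
    have hp : affinePt j (homChart j (γ t).2) = ((γ t).2 j)⁻¹ • (γ t).2 := affinePt_homChart h2
    have e2 := projConn_smul i (affinePt i (homChart i (γ t).1)) (γ t).2
      (homChartDeriv i (γ t).1 γ'.1) (homChartDeriv i (γ t).1 (ξ t).1) (inv_ne_zero h2)
    rw [← hp] at e2
    rw [← e2]
    rfl
  · have e := homChartDeriv_covariant (α' := ξ'.2) (q' := γ'.2) (p := (γ t).1) h2
      (by rw [dotProduct_comm]; exact mem_Q5_iff.1 hQ) (by rw [dotProduct_comm]; exact hξ2)
    have hk : (γ t).1 ⬝ᵥ γ'.2 = -((γ t).2 ⬝ᵥ γ'.1) := by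
      rw [dotProduct_comm]
      linarith
    rw [hk, neg_smul, sub_neg_eq_add] at e
    refine Eq.trans ?_ e
    have hp : affinePt i (homChart i (γ t).1) = ((γ t).1 i)⁻¹ • (γ t).1 := affinePt_homChart h1
    have e2 := projConn_smul j (affinePt j (homChart j (γ t).2)) (γ t).1
      (homChartDeriv j (γ t).2 γ'.2) (homChartDeriv j (γ t).2 (ξ t).2) (inv_ne_zero h1)
    rw [← hp] at e2
    rw [← e2]
    rfl

lemma trivializationAt_snd_eq {x₀ : RP2 × RP2} {x : RP2 × RP2} (hx : x ∈ (extChartAt I4 x₀).source)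
    (v : TangentSpace I4 x) :
    (trivializationAt (R2 × R2) (TangentSpace I4) x₀
      (⟨x, v⟩ : TangentBundle I4 (RP2 × RP2))).2 =
      (mfderiv I4 𝓘(ℝ, R2 × R2) (extChartAt I4 x₀) x v : R2 × R2) := by
  rw [extChartAt_source] at hx
  have h := TangentBundle.continuousLinearMapAt_trivializationAt (I := I4) hx
  have h2 := congrArg (fun A : R2 × R2 →L[ℝ] R2 × R2 => A v) h
  refine Eq.trans ?_ h2
  have h3 : x ∈ (trivializationAt (R2 × R2) (TangentSpace I4) x₀).baseSet := hx
  exact (Bundle.Trivialization.continuousLinearMapAt_apply_of_mem (R := ℝ) _ h3 v).symm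

lemma contDiffAt_homChartDeriv {i : Fin 3} {q α : ℝ → R3} {t : ℝ} (hq : ContDiffAt ℝ ∞ q t)
    (hα : ContDiffAt ℝ ∞ α t) (h : q t i ≠ 0) :
    ContDiffAt ℝ ∞ (fun s => homChartDeriv i (q s) (α s)) t := by
  refine contDiffAt_pi.2 fun k => ?_
  simp only [homChartDeriv_apply]
  have hq1 := contDiffAt_pi.1 hq
  have hα1 := contDiffAt_pi.1 hα
  exact (((hq1 i).inv h).mul (hα1 _)).sub
    (((hq1 _).div ((hq1 i).pow 2) (pow_ne_zero 2 h)).mul (hα1 i))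

lemma isSmoothAlong_of_dhopf {Γ : ℝ → RP2 × RP2} {J : Set ℝ} (hJ : IsOpen J)
    (V : ∀ t, TangentSpace I4 (Γ t)) {γ ξ : ℝ → R3 × R3} (hΓ : ∀ t ∈ J, Γ t = hopf (γ t))
    (hγ : ContDiffOn ℝ ∞ γ J) (hξ : ContDiffOn ℝ ∞ ξ J) (hQ : ∀ t ∈ J, γ t ∈ Q5)
    (hV : ∀ t ∈ J, (V t : R2 × R2) = dhopf (γ t) (ξ t)) : IsSmoothAlong I4 Γ V J := by
  intro t ht
  have hJt : J ∈ 𝓝 t := hJ.mem_nhds ht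
  have hγt := hγ.contDiffAt hJt
  have hξt := hξ.contDiffAt hJt
  refine ContMDiffAt.contMDiffWithinAt ?_
  rw [Bundle.contMDiffAt_totalSpace]
  have hz1 := fst_ne_zero_of_mem_Q5 (hQ t ht)
  have hz2 := snd_ne_zero_of_mem_Q5 (hQ t ht)
  have hΓe : Γ =ᶠ[𝓝 t] hopf ∘ γ := by
    filter_upwards [hJt] with s hs
    exact hΓ s hs
  refine ⟨((contMDiffAt_hopf hz1 hz2).comp t hγt.contMDiffAt).congr_of_eventuallyEq hΓe, ?_⟩
  obtain ⟨h1, h2⟩ := index_hopf_ne_zero hz1 hz2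
  rw [← hΓ t ht] at h1 h2
  have hne := eventually_coord_ne_zero hγt.continuousAt h1 h2
  have hev : (fun s => (trivializationAt (R2 × R2) (TangentSpace I4) (Γ t)
      (⟨Γ s, V s⟩ : TangentBundle I4 (RP2 × RP2))).2) =ᶠ[𝓝 t] fun s =>
      hopfChartDeriv (RP2.index (Γ t).1) (RP2.index (Γ t).2) (γ s) (ξ s) := by
    filter_upwards [hJt, hne] with s hs hs'
    have e : Γ s ∈ (extChartAt I4 (Γ t)).source := by
      rw [hΓ s hs, hopf_mem_extChartAt_source (fst_ne_zero_of_mem_Q5 (hQ s hs))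
        (snd_ne_zero_of_mem_Q5 (hQ s hs))]
      exact hs'
    refine (trivializationAt_snd_eq e (V s)).trans ?_
    refine Eq.trans ?_ (mfderiv_extChartAt_dhopf (hΓ s hs) hs'.1 hs'.2 (ξ s))
    exact congrArg (mfderiv I4 𝓘(ℝ, R2 × R2) (extChartAt I4 (Γ t)) (Γ s) :
      R2 × R2 →L[ℝ] R2 × R2) (hV s hs)
  refine ContMDiffAt.congr_of_eventuallyEq ?_ hev
  exact ((contDiffAt_homChartDeriv hγt.fst hξt.fst h1).prodMk
    (contDiffAt_homChartDeriv hγt.snd hξt.snd h2)).contMDiffAt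

lemma differentiableAt_localVectorField {Γ : ℝ → RP2 × RP2} {J : Set ℝ} (hJ : IsOpen J)
    {V : ∀ t, TangentSpace I4 (Γ t)} (hV : IsSmoothAlong I4 Γ V J) {t : ℝ} (ht : t ∈ J) :
    DifferentiableAt ℝ (localVectorField I4 Γ V (Γ t)) t := by
  have h := Bundle.contMDiffAt_totalSpace.1 ((hV t ht).contMDiffAt (hJ.mem_nhds ht))
  have h2 := (contMDiffAt_iff_contDiffAt.1 h.2).differentiableAt (by simp)
  refine h2.congr_of_eventuallyEq ?_
  have hs : ∀ᶠ s in 𝓝 t, Γ s ∈ (extChartAt I4 (Γ t)).source :=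
    h.1.continuousAt.eventually ((isOpen_extChartAt_source (I := I4) (Γ t)).mem_nhds
      (mem_extChartAt_source (I := I4) (Γ t)))
  filter_upwards [hs] with s hs
  exact (trivializationAt_snd_eq hs (V s)).symm

lemma differentiableAt_horizontalPart {z ξ : ℝ → R3 × R3} {t : ℝ} (hz : DifferentiableAt ℝ z t)
    (hξ : DifferentiableAt ℝ ξ t) :
    DifferentiableAt ℝ (fun s => horizontalPart (z s) (ξ s)) t := by
  simp only [horizontalPart_apply, dotProduct_fin3]
  fun_prop

lemma differentiableAt_affineLift {i j : Fin 3} {z : ℝ → R3 × R3} {v : ℝ → R2 × R2} {t : ℝ}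
    (hz : DifferentiableAt ℝ z t) (hv : DifferentiableAt ℝ v t) :
    DifferentiableAt ℝ (fun s => affineLift i j (z s) (v s)) t := by
  simp only [affineLift]
  fun_prop

/-! ## Self-dual null planes in homogeneous coordinates -/

lemma cross_dot_left (a b : R3) : crossProduct a b ⬝ᵥ a = 0 := by
  rw [dotProduct_comm, dot_self_cross]

lemma cross_dot_right (a b : R3) : crossProduct a b ⬝ᵥ b = 0 := by
  rw [dotProduct_comm, dot_cross_self]

lemma cross_dot_swap (a b c : R3) : crossProduct a c ⬝ᵥ b = -(crossProduct a b ⬝ᵥ c) := by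
  simp only [cross_apply, dotProduct_fin3, Matrix.cons_val_zero, Matrix.cons_val_one,
    Matrix.cons_val]
  ring

lemma eq_sum_of_dual_bases {a b : Fin 3 → R3} (h : ∀ i j, b i ⬝ᵥ a j = if i = j then 1 else 0)
    (x : R3) : x = (b 0 ⬝ᵥ x) • a 0 + (b 1 ⬝ᵥ x) • a 1 + (b 2 ⬝ᵥ x) • a 2 := by
  have h1 : Matrix.of b * (Matrix.of a)ᵀ = 1 := by
    ext i j
    rw [Matrix.mul_apply', Matrix.one_apply, ← h i j]
    rfl
  have h2 := mul_eq_one_comm.1 h1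
  have h3 : (Matrix.of a)ᵀ *ᵥ (Matrix.of b *ᵥ x) = x := by
    rw [Matrix.mulVec_mulVec, h2, Matrix.one_mulVec]
  have h4 : (Matrix.of a)ᵀ *ᵥ (Matrix.of b *ᵥ x) =
      (b 0 ⬝ᵥ x) • a 0 + (b 1 ⬝ᵥ x) • a 1 + (b 2 ⬝ᵥ x) • a 2 := by
    funext r
    have e : ((Matrix.of a)ᵀ *ᵥ (Matrix.of b *ᵥ x)) r =
      (fun l => a l r) ⬝ᵥ (fun l => b l ⬝ᵥ x) := rfl
    rw [e, dotProduct_fin3]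
    simp only [Pi.add_apply, Pi.smul_apply, smul_eq_mul]
    ring
  exact h3.symm.trans h4

lemma eq_combination_of_dual {q p a₀ a₁ b₀ b₁ : R3} (hpq : p ⬝ᵥ q = 1) (hp0 : p ⬝ᵥ a₀ = 0)
    (hp1 : p ⬝ᵥ a₁ = 0) (h0q : b₀ ⬝ᵥ q = 0) (h1q : b₁ ⬝ᵥ q = 0) (h00 : b₀ ⬝ᵥ a₀ = 1)
    (h01 : b₀ ⬝ᵥ a₁ = 0) (h10 : b₁ ⬝ᵥ a₀ = 0) (h11 : b₁ ⬝ᵥ a₁ = 1) (x : R3) :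
    x = (p ⬝ᵥ x) • q + (b₀ ⬝ᵥ x) • a₀ + (b₁ ⬝ᵥ x) • a₁ := by
  refine eq_sum_of_dual_bases (a := ![q, a₀, a₁]) (b := ![p, b₀, b₁]) ?_ x
  intro i j
  fin_cases i <;> fin_cases j <;> simp [hpq, hp0, hp1, h0q, h1q, h00, h01, h10, h11]

lemma mem_distD_iff {z : R3 × R3} {ξ : R3 × R3} :
    ξ ∈ distD z ↔ z.2 ⬝ᵥ ξ.1 = 0 ∧ ξ.2 = crossProduct z.1 ξ.1 := by
  have h : ξ ∈ distD z ↔ ξ.2 ⬝ᵥ z.1 + z.2 ⬝ᵥ ξ.1 = 0 ∧ ξ.2 = crossProduct z.1 ξ.1 := Iff.rfl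
  rw [h]
  refine ⟨fun ⟨h1, h2⟩ => ⟨?_, h2⟩, fun ⟨h1, h2⟩ => ⟨?_, h2⟩⟩
  · rwa [h2, cross_dot_left, zero_add] at h1
  · rw [h2, cross_dot_left, zero_add, h1]

lemma snd_dot_of_mem_distD {z ξ : R3 × R3} (h : ξ ∈ distD z) : ξ.2 ⬝ᵥ z.1 = 0 := by
  rw [(mem_distD_iff.1 h).2, cross_dot_left]

lemma horizontalPart_eq_self {z ξ : R3 × R3} (h1 : z.2 ⬝ᵥ ξ.1 = 0) (h2 : ξ.2 ⬝ᵥ z.1 = 0) :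
    horizontalPart z ξ = ξ := by
  rw [horizontalPart_apply, h1, h2, zero_smul, zero_smul, sub_zero, sub_zero]

lemma horizontalPart_of_mem_distD {z ξ : R3 × R3} (h : ξ ∈ distD z) : horizontalPart z ξ = ξ :=
  horizontalPart_eq_self (mem_distD_iff.1 h).1 (snd_dot_of_mem_distD h)

/-- The projection to `M⁴` of the distribution at `z`. -/
noncomputable def sdPlane (z : R3 × R3) : Submodule ℝ (R2 × R2) :=
  (distD z).map (dhopf z).toLinearMap

lemma mem_sdPlane {z : R3 × R3} {v : R2 × R2} : v ∈ sdPlane z ↔ ∃ ξ ∈ distD z, dhopf z ξ = v :=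
  Submodule.mem_map

lemma horizontalPart_eq_of_dhopf_eq {z : R3 × R3} (hz : z ∈ Q5) {ξ ζ : R3 × R3}
    (h : dhopf z ξ = dhopf z ζ) : horizontalPart z ξ = horizontalPart z ζ := by
  obtain ⟨h1, h2⟩ := index_hopf_ne_zero (fst_ne_zero_of_mem_Q5 hz) (snd_ne_zero_of_mem_Q5 hz)
  exact horizontalPart_eq_of_hopfChartDeriv_eq hz h1 h2 h

lemma dhopf_horizontalPart {z : R3 × R3} (hz : z ∈ Q5) (ξ : R3 × R3) :
    dhopf z (horizontalPart z ξ) = dhopf z ξ := by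
  obtain ⟨h1, h2⟩ := index_hopf_ne_zero (fst_ne_zero_of_mem_Q5 hz) (snd_ne_zero_of_mem_Q5 hz)
  exact hopfChartDeriv_horizontalPart h1 h2 ξ

lemma flatMetric_distD {z ξ ζ : R3 × R3} (hξ : ξ ∈ distD z) (hζ : ζ ∈ distD z) :
    flatMetric ξ ζ = 0 := by
  rw [flatMetric_apply, (mem_distD_iff.1 hξ).2, (mem_distD_iff.1 hζ).2,
    cross_dot_swap z.1 ξ.1 ζ.1]
  ring

lemma exists_orthogonal (p : R3) : ∃ a : R3, a ≠ 0 ∧ p ⬝ᵥ a = 0 := by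
  by_cases h : p 0 = 0 ∧ p 1 = 0
  · refine ⟨![1, 0, 0], fun h0 => one_ne_zero (congrFun h0 0), ?_⟩
    rw [dotProduct_fin3]
    simp [h.1]
  · refine ⟨![p 1, -p 0, 0], fun h0 => h ⟨?_, ?_⟩, ?_⟩
    · simpa using congrFun h0 1
    · simpa using congrFun h0 0
    · rw [dotProduct_fin3]
      simp
      ring

lemma isSelfDualPlane_of_mem {V : Type*} [AddCommGroup V] [Module ℝ V] {e : Fin 4 → V}
    {W : Submodule ℝ V} (hW : finrank ℝ W = 2) (c : ℝ) (h0 : e 0 - c • e 3 ∈ W)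
    (h1 : e 1 + c • e 2 ∈ W) : IsSelfDualPlane e W := by
  refine ⟨hW, fun θ₁ hθ₁ θ₂ hθ₂ ξ₁ ξ₂ => ?_⟩
  have key : ∀ θ ∈ W.dualAnnihilator, θ (e 0) = c * θ (e 3) ∧ θ (e 1) = -(c * θ (e 2)) := by
    intro θ hθ
    rw [Submodule.mem_dualAnnihilator] at hθ
    have a0 := hθ _ h0
    have a1 := hθ _ h1
    simp only [map_sub, map_add, map_smul, smul_eq_mul] at a0 a1
    exact ⟨by linarith, by linarith⟩
  obtain ⟨a0, a1⟩ := key θ₁ hθ₁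
  obtain ⟨b0, b1⟩ := key θ₂ hθ₂
  simp only [wedgeFour, coInner, Matrix.det_succ_row_zero, Fin.sum_univ_succ, Matrix.of_apply,
    Matrix.submatrix_apply, Fin.succAbove, Matrix.cons_val_zero, Matrix.cons_val_succ]
  simp [a0, a1, b0, b1, Fin.lt_def]
  ring

lemma IsSelfDualPlane.relations {V : Type*} [AddCommGroup V] [Module ℝ V] {e : Fin 4 → V}
    {W : Submodule ℝ V} (hW : IsSelfDualPlane e W) {f : Fin 4 → Dual ℝ V}
    (hf : ∀ i j, f i (e j) = if i = j then 1 else 0) {θ₁ θ₂ : Dual ℝ V}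
    (hθ₁ : θ₁ ∈ W.dualAnnihilator) (hθ₂ : θ₂ ∈ W.dualAnnihilator) :
    θ₁ (e 1) * θ₂ (e 2) = θ₁ (e 2) * θ₂ (e 1) ∧ θ₁ (e 0) * θ₂ (e 3) = θ₁ (e 3) * θ₂ (e 0) ∧
      θ₁ (e 0) * θ₂ (e 2) - θ₁ (e 2) * θ₂ (e 0) = θ₁ (e 1) * θ₂ (e 3) - θ₁ (e 3) * θ₂ (e 1) := by
  have h03 := hW.2 θ₁ hθ₁ θ₂ hθ₂ (f 0) (f 3)
  have h12 := hW.2 θ₁ hθ₁ θ₂ hθ₂ (f 1) (f 2)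
  have h02 := hW.2 θ₁ hθ₁ θ₂ hθ₂ (f 0) (f 2)
  simp only [wedgeFour, coInner, Matrix.det_succ_row_zero, Fin.sum_univ_succ, Matrix.of_apply,
    Matrix.submatrix_apply, Fin.succAbove, Matrix.cons_val_zero, Matrix.cons_val_succ] at h03 h12 h02
  simp [hf, Fin.lt_def] at h03 h12 h02
  refine ⟨by linarith, by linarith, by linarith⟩

lemma isSDNullPlane_sdPlane {ρ : RP2 × RP2 → ℝ} {z : R3 × R3} (hz : z ∈ Q5)
    (hρ : 0 < ρ (hopf z)) : IsSDNullPlane (conformalMetric ρ) (hopf z) (sdPlane z) := by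
  have hpq : z.2 ⬝ᵥ z.1 = 1 := hz
  refine ⟨fun v hv => ?_, ?_⟩
  · obtain ⟨ξ, hξ, rfl⟩ := mem_sdPlane.1 hv
    rw [conformalMetric_dhopf ρ hz, horizontalPart_of_mem_distD hξ, flatMetric_distD hξ hξ,
      mul_zero]
  set r := ρ (hopf z) with hr
  obtain ⟨a₀, ha0, hp0⟩ := exists_orthogonal z.2
  set a₁ := crossProduct z.2 a₀ with ha1
  have hp1 : z.2 ⬝ᵥ a₁ = 0 := dot_self_cross _ _
  set D := crossProduct z.1 a₀ ⬝ᵥ a₁ with hD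
  have hD0 : D ≠ 0 := by
    have : D = a₀ ⬝ᵥ a₀ := by
      rw [hD, ha1, cross_dot_cross, dotProduct_comm a₀ z.2, hp0, dotProduct_comm z.1, hpq]
      ring
    rw [this]
    exact fun h => ha0 (eq_zero_of_dotProduct_self_eq_zero h)
  set b₀ : R3 := (r * D)⁻¹ • crossProduct z.1 a₁ with hb0
  set b₁ : R3 := -((r * D)⁻¹ • crossProduct z.1 a₀) with hb1
  have hrD : r * D ≠ 0 := mul_ne_zero hρ.ne' hD0
  have hb0q : b₀ ⬝ᵥ z.1 = 0 := by rw [hb0, smul_dotProduct, cross_dot_left, smul_zero]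
  have hb1q : b₁ ⬝ᵥ z.1 = 0 := by
    rw [hb1, neg_dotProduct, smul_dotProduct, cross_dot_left, smul_zero, neg_zero]
  have h00 : b₀ ⬝ᵥ a₀ = -r⁻¹ := by
    rw [hb0, smul_dotProduct, cross_dot_swap, ← hD, smul_eq_mul]
    field_simp
  have h01 : b₀ ⬝ᵥ a₁ = 0 := by rw [hb0, smul_dotProduct, cross_dot_right, smul_zero]
  have h10 : b₁ ⬝ᵥ a₀ = 0 := by
    rw [hb1, neg_dotProduct, smul_dotProduct, cross_dot_right, smul_zero, neg_zero]
  have h11 : b₁ ⬝ᵥ a₁ = -r⁻¹ := by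
    rw [hb1, neg_dotProduct, smul_dotProduct, ← hD, smul_eq_mul]
    field_simp
  set E : Fin 4 → R3 × R3 := ![(a₀, 0), (a₁, 0), (0, b₀), (0, b₁)] with hE
  have hEh : ∀ k, horizontalPart z (E k) = E k := fun k => by
    refine horizontalPart_eq_self ?_ ?_ <;> fin_cases k <;> simp [hE, hp0, hp1, hb0q, hb1q]
  have hx0 : crossProduct z.1 a₀ = -(r * D) • b₁ := by
    rw [hb1, smul_neg, neg_smul, neg_neg, smul_smul, mul_inv_cancel₀ hrD, one_smul]
  have hx1 : crossProduct z.1 a₁ = (r * D) • b₀ := by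
    rw [hb0, smul_smul, mul_inv_cancel₀ hrD, one_smul]
  have hd0 : (a₀, crossProduct z.1 a₀) ∈ distD z := mem_distD_iff.2 ⟨hp0, rfl⟩
  have hd1 : (a₁, crossProduct z.1 a₁) ∈ distD z := mem_distD_iff.2 ⟨hp1, rfl⟩
  have hw0 : dhopf z (E 0) - (r * D) • dhopf z (E 3) = dhopf z (a₀, crossProduct z.1 a₀) := by
    rw [← map_smul, ← map_sub, hx0]
    congr 1
    simp [hE]
  have hw1 : dhopf z (E 1) + (r * D) • dhopf z (E 2) = dhopf z (a₁, crossProduct z.1 a₁) := by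
    rw [← map_smul, ← map_add, hx1]
    congr 1
    simp [hE]
  have hspan : sdPlane z = Submodule.span ℝ (Set.range
      ![dhopf z (a₀, crossProduct z.1 a₀), dhopf z (a₁, crossProduct z.1 a₁)]) := by
    refine le_antisymm ?_ ?_
    · intro v hv
      obtain ⟨ξ, hξ, rfl⟩ := mem_sdPlane.1 hv
      obtain ⟨e1, e2⟩ := mem_distD_iff.1 hξ
      have e3 := eq_combination_of_dual (b₀ := -r • b₀) (b₁ := -r • b₁) hpq hp0 hp1
        (by simp [hb0q]) (by simp [hb1q]) (by simp [h00, hρ.ne'])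
        (by simp [h01]) (by simp [h10]) (by simp [h11, hρ.ne']) ξ.1
      rw [e1, zero_smul, zero_add] at e3
      set c₀ := (-r • b₀) ⬝ᵥ ξ.1
      set c₁ := (-r • b₁) ⬝ᵥ ξ.1
      have e4 : ξ = c₀ • (a₀, crossProduct z.1 a₀) + c₁ • (a₁, crossProduct z.1 a₁) := by
        refine Prod.ext e3 ?_
        rw [e2, e3]
        simp
      rw [e4, map_add, map_smul, map_smul]
      exact add_mem (Submodule.smul_mem _ _ (Submodule.subset_span ⟨0, rfl⟩))
        (Submodule.smul_mem _ _ (Submodule.subset_span ⟨1, rfl⟩))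
    · rw [Submodule.span_le]
      rintro _ ⟨k, rfl⟩
      fin_cases k
      · exact mem_sdPlane.2 ⟨_, hd0, rfl⟩
      · exact mem_sdPlane.2 ⟨_, hd1, rfl⟩
  have hrank : finrank ℝ (sdPlane z) = 2 := by
    rw [hspan]
    refine (finrank_span_eq_card ?_).trans (by simp)
    rw [LinearIndependent.pair_iff]
    intro s t hst
    rw [← map_smul, ← map_smul, ← map_add, ← map_zero (dhopf z)] at hst
    have e := horizontalPart_eq_of_dhopf_eq hz hst
    rw [map_zero, horizontalPart_of_mem_distD (add_mem (Submodule.smul_mem _ _ hd0)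
      (Submodule.smul_mem _ _ hd1))] at e
    have e1 : s • a₀ + t • a₁ = 0 := congrArg Prod.fst e
    have e2 := congrArg (fun x => b₀ ⬝ᵥ x) e1
    have e3 := congrArg (fun x => b₁ ⬝ᵥ x) e1
    simp [dotProduct_add, h00, h01, h10, h11, hρ.ne'] at e2 e3
    exact ⟨e2, e3⟩
  refine ⟨fun k => dhopf z (E k), ⟨?_, ?_, ?_⟩, isSelfDualPlane_of_mem hrank (r * D) ?_ ?_⟩
  · intro k l
    rw [conformalMetric_dhopf ρ hz, hEh, hEh, ← hr, flatMetric_apply]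
    fin_cases k <;> fin_cases l <;> simp [hE, h00, h01, h10, h11, hρ.ne']
  · intro k hk
    rw [mfderiv_snd]
    have e : (E k).2 = 0 := by
      fin_cases k
      · rfl
      · rfl
      · exact absurd hk (by decide)
      · exact absurd hk (by decide)
    exact (congrArg (homChartDeriv (RP2.index (hopf z).2) z.2) e).trans (map_zero _)
  · intro k hk
    rw [mfderiv_fst]
    have e : (E k).1 = 0 := by
      fin_cases k
      · exact absurd hk (by decide)
      · exact absurd hk (by decide)
      · rfl
      · rfl
    exact (congrArg (homChartDeriv (RP2.index (hopf z).1) z.1) e).trans (map_zero _)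
  · exact mem_sdPlane.2 ⟨_, hd0, hw0.symm⟩
  · exact mem_sdPlane.2 ⟨_, hd1, hw1.symm⟩

/-- A horizontal vector satisfying the self-duality relations with a vector of the distribution is
in the distribution. -/
lemma snd_eq_cross_of_relations {q p a₀ a₁ b₀ b₁ u u' v : R3} (hpq : p ⬝ᵥ q = 1)
    (hp0 : p ⬝ᵥ a₀ = 0) (hp1 : p ⬝ᵥ a₁ = 0) (h0q : b₀ ⬝ᵥ q = 0) (h1q : b₁ ⬝ᵥ q = 0)
    (h00 : b₀ ⬝ᵥ a₀ = 1) (h01 : b₀ ⬝ᵥ a₁ = 0) (h10 : b₁ ⬝ᵥ a₀ = 0) (h11 : b₁ ⬝ᵥ a₁ = 1)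
    (hpu : p ⬝ᵥ u = 0) (hu'q : u' ⬝ᵥ q = 0) (hpv : p ⬝ᵥ v = 0) (hv : v ≠ 0)
    (horth : u' ⬝ᵥ v + crossProduct q v ⬝ᵥ u = 0)
    (r1 : (crossProduct q v ⬝ᵥ a₁) * (b₀ ⬝ᵥ u) = (b₀ ⬝ᵥ v) * (u' ⬝ᵥ a₁))
    (r2 : (crossProduct q v ⬝ᵥ a₀) * (b₁ ⬝ᵥ u) = (b₁ ⬝ᵥ v) * (u' ⬝ᵥ a₀))
    (r3 : (crossProduct q v ⬝ᵥ a₀) * (b₀ ⬝ᵥ u) - (b₀ ⬝ᵥ v) * (u' ⬝ᵥ a₀) =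
      (crossProduct q v ⬝ᵥ a₁) * (b₁ ⬝ᵥ u) - (b₁ ⬝ᵥ v) * (u' ⬝ᵥ a₁)) :
    u' = crossProduct q u := by
  have eu := eq_combination_of_dual hpq hp0 hp1 h0q h1q h00 h01 h10 h11 u
  have ev := eq_combination_of_dual hpq hp0 hp1 h0q h1q h00 h01 h10 h11 v
  rw [hpu, zero_smul, zero_add] at eu
  rw [hpv, zero_smul, zero_add] at ev
  set u₀ := b₀ ⬝ᵥ u
  set u₁ := b₁ ⬝ᵥ u
  set v₀ := b₀ ⬝ᵥ v
  set v₁ := b₁ ⬝ᵥ v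
  set D := crossProduct q a₀ ⬝ᵥ a₁ with hD
  have hv01 : ¬ (v₀ = 0 ∧ v₁ = 0) := fun h => hv (by rw [ev, h.1, h.2]; simp)
  have cross0 : ∀ c₀ c₁ : ℝ, crossProduct q (c₀ • a₀ + c₁ • a₁) ⬝ᵥ a₀ = -(c₁ * D) := by
    intro c₀ c₁
    simp [add_dotProduct, smul_dotProduct, cross_dot_right, cross_dot_swap q a₀ a₁, ← hD]
  have cross1 : ∀ c₀ c₁ : ℝ, crossProduct q (c₀ • a₀ + c₁ • a₁) ⬝ᵥ a₁ = c₀ * D := by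
    intro c₀ c₁
    simp [add_dotProduct, smul_dotProduct, cross_dot_right, ← hD]
  have hv0 : crossProduct q v ⬝ᵥ a₀ = -(v₁ * D) := by rw [ev, cross0]
  have hv1 : crossProduct q v ⬝ᵥ a₁ = v₀ * D := by rw [ev, cross1]
  have ho : v₀ * (u' ⬝ᵥ a₀) + v₁ * (u' ⬝ᵥ a₁) + (u₁ * (v₀ * D) - u₀ * (v₁ * D)) = 0 := by
    have h1 : u' ⬝ᵥ v = v₀ * (u' ⬝ᵥ a₀) + v₁ * (u' ⬝ᵥ a₁) := by
      conv_lhs => rw [ev]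
      simp [dotProduct_add, dotProduct_smul]
    have h2 : crossProduct q v ⬝ᵥ u = u₁ * (v₀ * D) - u₀ * (v₁ * D) := by
      conv_lhs => rw [eu]
      rw [dotProduct_add, dotProduct_smul, dotProduct_smul, hv0, hv1]
      simp only [smul_eq_mul]
      ring
    rw [h1, h2] at horth
    exact horth
  rw [hv0] at r2 r3
  rw [hv1] at r1 r3
  have g0 : u' ⬝ᵥ a₀ = -(u₁ * D) := by
    rcases eq_or_ne v₀ 0 with h | h
    · have hne : v₁ ≠ 0 := fun h' => hv01 ⟨h, h'⟩
      refine mul_left_cancel₀ hne ?_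
      linarith
    · refine mul_left_cancel₀ h ?_
      linarith
  have g1 : u' ⬝ᵥ a₁ = u₀ * D := by
    rcases eq_or_ne v₀ 0 with h | h
    · have hne : v₁ ≠ 0 := fun h' => hv01 ⟨h, h'⟩
      refine mul_left_cancel₀ hne ?_
      linarith
    · refine mul_left_cancel₀ h ?_
      linarith
  have c0 : crossProduct q u ⬝ᵥ a₀ = -(u₁ * D) := by
    conv_lhs => rw [eu]
    exact cross0 _ _
  have c1 : crossProduct q u ⬝ᵥ a₁ = u₀ * D := by
    conv_lhs => rw [eu]
    exact cross1 _ _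
  have hfin := eq_combination_of_dual (q := p) (p := q) (a₀ := b₀) (a₁ := b₁) (b₀ := a₀)
    (b₁ := a₁) (by rwa [dotProduct_comm]) (by rwa [dotProduct_comm]) (by rwa [dotProduct_comm])
    (by rwa [dotProduct_comm]) (by rwa [dotProduct_comm]) (by rwa [dotProduct_comm])
    (by rwa [dotProduct_comm]) (by rwa [dotProduct_comm]) (by rwa [dotProduct_comm])
    (u' - crossProduct q u)
  rw [dotProduct_sub, dotProduct_sub, dotProduct_sub, dotProduct_comm q u', hu'q,
    dot_self_cross, dotProduct_comm a₀ u', dotProduct_comm a₁ u', dotProduct_comm a₀,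
    dotProduct_comm a₁, g0, g1, c0, c1] at hfin
  simp only [sub_self, zero_smul, add_zero] at hfin
  exact sub_eq_zero.1 hfin

/-- The tangent vector `v`, at the projection of `z`, lifted to a horizontal vector at `z`. -/
lemma exists_horizontal_lift {z : R3 × R3} (hz : z ∈ Q5) (v : R2 × R2) :
    ∃ ξ : R3 × R3, dhopf z ξ = v ∧ z.2 ⬝ᵥ ξ.1 = 0 ∧ ξ.2 ⬝ᵥ z.1 = 0 ∧
      (v.1 = 0 → ξ.1 = 0) ∧ (v.2 = 0 → ξ.2 = 0) := by
  obtain ⟨h1, h2⟩ := index_hopf_ne_zero (fst_ne_zero_of_mem_Q5 hz) (snd_ne_zero_of_mem_Q5 hz)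
  set i := RP2.index (hopf z).1
  set j := RP2.index (hopf z).2
  refine ⟨horizontalPart z (affineLift i j z v), ?_, (horizontalPart_idem hz _).1,
    (horizontalPart_idem hz _).2, fun h => ?_, fun h => ?_⟩
  · exact (dhopf_horizontalPart hz _).trans (hopfChartDeriv_affineLift h1 h2 v)
  · simp [horizontalPart_apply, affineLift, h]
  · simp [horizontalPart_apply, affineLift, h]

/-- A self-dual null plane containing a vector of the projected distribution is contained in the
projected distribution. -/
lemma mem_sdPlane_of_isSDNullPlane {ρ : RP2 × RP2 → ℝ} {m : RP2 × RP2} {z : R3 × R3}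
    (hz : z ∈ Q5) (hm : m = hopf z) (hρ : 0 < ρ m) {W : Submodule ℝ (TangentSpace I4 m)}
    (hW : IsSDNullPlane (conformalMetric ρ) m W) {ξ : R3 × R3} (hξ : ξ ∈ distD z)
    (hξ0 : ξ.1 ≠ 0) (hV : dhopf z ξ ∈ W) {u : R2 × R2} (hu : u ∈ W) : u ∈ sdPlane z := by
  subst hm
  obtain ⟨hnull, e, ⟨hframe, hsnd, hfst⟩, hsd⟩ := hW
  set r := ρ (hopf z) with hr
  have hg : ∀ a b : R3 × R3, z.2 ⬝ᵥ a.1 = 0 → a.2 ⬝ᵥ z.1 = 0 → z.2 ⬝ᵥ b.1 = 0 →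
      b.2 ⬝ᵥ z.1 = 0 → metricAt (conformalMetric ρ) (hopf z) (dhopf z a) (dhopf z b) =
        -r * (a.2 ⬝ᵥ b.1 + b.2 ⬝ᵥ a.1) := by
    intro a b h1 h2 h3 h4
    rw [conformalMetric_dhopf ρ hz, horizontalPart_eq_self h1 h2, horizontalPart_eq_self h3 h4,
      flatMetric_apply, ← hr]
    ring
  choose E hE hE1 hE2 hE3 hE4 using fun k => exists_horizontal_lift hz (e k)
  have hs : ∀ k : Fin 4, k < 2 → (E k).2 = 0 := fun k hk => hE4 k (by
    have := hsnd k hk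
    rw [mfderiv_snd] at this
    exact this)
  have hf : ∀ k : Fin 4, 2 ≤ k → (E k).1 = 0 := fun k hk => hE3 k (by
    have := hfst k hk
    rw [mfderiv_fst] at this
    exact this)
  have s0 := hs 0 (by decide)
  have s1 := hs 1 (by decide)
  have f2 := hf 2 (by decide)
  have f3 := hf 3 (by decide)
  have hpair : ∀ k l, -r * ((E k).2 ⬝ᵥ (E l).1 + (E l).2 ⬝ᵥ (E k).1) =
      !![(0 : ℝ), 0, 1, 0; 0, 0, 0, 1; 1, 0, 0, 0; 0, 1, 0, 0] k l := fun k l => by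
    rw [← hg (E k) (E l) (hE1 k) (hE2 k) (hE1 l) (hE2 l), hE, hE]
    exact hframe k l
  have h20 : -r * ((E 2).2 ⬝ᵥ (E 0).1) = 1 := by simpa [s0] using hpair 2 0
  have h21 : -r * ((E 2).2 ⬝ᵥ (E 1).1) = 0 := by simpa [s1] using hpair 2 1
  have h30 : -r * ((E 3).2 ⬝ᵥ (E 0).1) = 0 := by simpa [s0] using hpair 3 0
  have h31 : -r * ((E 3).2 ⬝ᵥ (E 1).1) = 1 := by simpa [s1] using hpair 3 1
  obtain ⟨η, hη, η1, η2, -, -⟩ := exists_horizontal_lift hz u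
  obtain ⟨ξ1, ξ2⟩ := mem_distD_iff.1 hξ
  have ξ3 := snd_dot_of_mem_distD hξ
  let θ : R2 × R2 → Dual ℝ (TangentSpace I4 (hopf z)) := fun v =>
    (conformalMetric ρ (hopf z) v).toLinearMap
  have hθ : ∀ v w : R2 × R2, θ v w = metricAt (conformalMetric ρ) (hopf z) v w := fun _ _ => rfl
  have hann : ∀ v ∈ W, θ v ∈ W.dualAnnihilator := by
    intro v hv
    rw [Submodule.mem_dualAnnihilator]
    intro w hw
    obtain ⟨a, rfl, a1, a2, -, -⟩ := exists_horizontal_lift hz v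
    obtain ⟨b, rfl, b1, b2, -, -⟩ := exists_horizontal_lift hz w
    have n1 := hnull _ hv
    have n2 := hnull _ hw
    have hvw : dhopf z (a + b) ∈ W := by
      rw [map_add]
      exact add_mem hv hw
    have n3 := hnull _ hvw
    rw [hg _ _ a1 a2 a1 a2] at n1
    rw [hg _ _ b1 b2 b1 b2] at n2
    rw [hg (a + b) (a + b) (by simp [dotProduct_add, a1, b1]) (by simp [add_dotProduct, a2, b2])
      (by simp [dotProduct_add, a1, b1]) (by simp [add_dotProduct, a2, b2])] at n3
    refine (hθ _ _).trans ?_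
    rw [hg _ _ a1 a2 b1 b2]
    simp only [Prod.fst_add, Prod.snd_add, add_dotProduct, dotProduct_add] at n3
    linarith
  have hdual : ∀ i j, (![θ (e 2), θ (e 3), θ (e 0), θ (e 1)] : Fin 4 → Dual ℝ _) i (e j) =
      if i = j then 1 else 0 := by
    intro i j
    fin_cases i
    · refine (hframe 2 j).trans ?_
      fin_cases j <;> simp
    · refine (hframe 3 j).trans ?_
      fin_cases j <;> simp
    · refine (hframe 0 j).trans ?_
      fin_cases j <;> simp
    · refine (hframe 1 j).trans ?_
      fin_cases j <;> simp
  obtain ⟨r1, r2, r3⟩ := hsd.relations hdual (hann _ hV) (hann _ hu)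
  have hval : ∀ (a : R3 × R3), z.2 ⬝ᵥ a.1 = 0 → a.2 ⬝ᵥ z.1 = 0 → ∀ k,
      θ (dhopf z a) (e k) = -r * (a.2 ⬝ᵥ (E k).1 + (E k).2 ⬝ᵥ a.1) := fun a a1 a2 k => by
    rw [← hg a (E k) a1 a2 (hE1 k) (hE2 k), hE]
    rfl
  have horth : θ (dhopf z η) (dhopf z ξ) = 0 := by
    have := hann _ hu
    rw [Submodule.mem_dualAnnihilator] at this
    rw [hη]
    exact this _ hV
  have horth' := (hg _ _ η1 η2 ξ1 ξ3).symm.trans horth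
  rw [← hη] at r1 r2 r3
  rw [hval _ ξ1 ξ3, hval _ ξ1 ξ3, hval _ η1 η2, hval _ η1 η2] at r1 r2
  rw [hval _ ξ1 ξ3, hval _ ξ1 ξ3, hval _ ξ1 ξ3, hval _ ξ1 ξ3, hval _ η1 η2, hval _ η1 η2,
    hval _ η1 η2, hval _ η1 η2] at r3
  simp only [s0, s1, f2, f3, zero_dotProduct, dotProduct_zero, add_zero, zero_add, ξ2] at r1 r2 r3
  rw [ξ2] at horth'
  have hrr : -r ≠ 0 := neg_ne_zero.2 hρ.ne'
  refine mem_sdPlane.2 ⟨η, mem_distD_iff.2 ⟨η1, ?_⟩, hη⟩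
  refine snd_eq_cross_of_relations (b₀ := -r • (E 2).2) (b₁ := -r • (E 3).2) hz (hE1 0) (hE1 1)
    (by simp [hE2]) (by simp [hE2]) (by simpa using h20) (by simpa using h21) (by simpa using h30)
    (by simpa using h31) η1 η2 ξ1 hξ0 ((mul_eq_zero.1 horth').resolve_left hrr) ?_ ?_ ?_
  · refine mul_left_cancel₀ hrr ?_
    simp only [smul_dotProduct, smul_eq_mul]
    linear_combination r1
  · refine mul_left_cancel₀ hrr ?_
    simp only [smul_dotProduct, smul_eq_mul]
    linear_combination r2
  · refine mul_left_cancel₀ hrr ?_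
    simp only [smul_dotProduct, smul_eq_mul]
    linear_combination r3

/-! ## Integral curves and their projections -/

lemma eq_zero_of_cross_eq_zero {q p u : R3} (hpq : p ⬝ᵥ q = 1) (hpu : p ⬝ᵥ u = 0)
    (h : crossProduct q u = 0) : u = 0 := by
  have h0 := congrFun h 0
  have h1 := congrFun h 1
  have h2 := congrFun h 2
  rw [dotProduct_fin3] at hpq hpu
  simp only [cross_apply, Matrix.cons_val_zero, Matrix.cons_val_one, Matrix.cons_val,
    Pi.zero_apply] at h0 h1 h2
  funext k
  fin_cases k <;> simp only [Fin.zero_eta, Fin.mk_one, Fin.reduceFinMk, Pi.zero_apply]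
  · linear_combination -(u 0) * hpq + q 0 * hpu - p 1 * h2 + p 2 * h1
  · linear_combination -(u 1) * hpq + q 1 * hpu - p 2 * h0 + p 0 * h2
  · linear_combination -(u 2) * hpq + q 2 * hpu - p 0 * h1 + p 1 * h0

lemma cross_eq_smul_of_orthogonal {q p u v : R3} (hpq : p ⬝ᵥ q = 1) (hpu : p ⬝ᵥ u = 0)
    (hpv : p ⬝ᵥ v = 0) : crossProduct u v = (crossProduct u v ⬝ᵥ q) • p := by
  rw [dotProduct_fin3] at hpq hpu hpv
  funext k
  fin_cases k <;> simp only [cross_apply, dotProduct_fin3, Pi.smul_apply, smul_eq_mul,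
    Fin.zero_eta, Fin.mk_one, Fin.reduceFinMk, Matrix.cons_val_zero, Matrix.cons_val_one,
    Matrix.cons_val]
  · linear_combination -(u 1 * v 2 - u 2 * v 1) * hpq + (q 1 * v 2 - q 2 * v 1) * hpu -
      (q 1 * u 2 - q 2 * u 1) * hpv
  · linear_combination -(u 2 * v 0 - u 0 * v 2) * hpq + (q 2 * v 0 - q 0 * v 2) * hpu -
      (q 2 * u 0 - q 0 * u 2) * hpv
  · linear_combination -(u 0 * v 1 - u 1 * v 0) * hpq + (q 0 * v 1 - q 1 * v 0) * hpu -
      (q 0 * u 1 - q 1 * u 0) * hpv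

lemma hasDerivAt_prod_fst {f : ℝ → R3 × R3} {f' : R3 × R3} {t : ℝ} (h : HasDerivAt f f' t) :
    HasDerivAt (fun s => (f s).1) f'.1 t :=
  (ContinuousLinearMap.fst ℝ R3 R3).hasFDerivAt.comp_hasDerivAt t h

lemma hasDerivAt_prod_snd {f : ℝ → R3 × R3} {f' : R3 × R3} {t : ℝ} (h : HasDerivAt f f' t) :
    HasDerivAt (fun s => (f s).2) f'.2 t :=
  (ContinuousLinearMap.snd ℝ R3 R3).hasFDerivAt.comp_hasDerivAt t h

lemma fst_ne_zero_of_mem_distD {z ξ : R3 × R3} (hξ : ξ ∈ distD z) (h : ξ ≠ 0) : ξ.1 ≠ 0 :=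
  fun h1 => h (Prod.ext h1 (by rw [(mem_distD_iff.1 hξ).2, h1, map_zero]; rfl))

lemma snd_ne_zero_of_mem_distD {z ξ : R3 × R3} (hz : z ∈ Q5) (hξ : ξ ∈ distD z) (h : ξ ≠ 0) :
    ξ.2 ≠ 0 := fun h2 => by
  obtain ⟨e1, e2⟩ := mem_distD_iff.1 hξ
  rw [h2] at e2
  exact fst_ne_zero_of_mem_distD hξ h (eq_zero_of_cross_eq_zero hz e1 e2.symm)

lemma dhopf_fst_eq_zero {z ξ : R3 × R3} (hz : z ∈ Q5) (h1 : z.2 ⬝ᵥ ξ.1 = 0)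
    (h : (dhopf z ξ).1 = 0) : ξ.1 = 0 := by
  obtain ⟨e1, -⟩ := index_hopf_ne_zero (fst_ne_zero_of_mem_Q5 hz) (snd_ne_zero_of_mem_Q5 hz)
  obtain ⟨c, hc⟩ : ∃ c : ℝ, ξ.1 = c • z.1 := ⟨_, homChartDeriv_eq_zero e1 h⟩
  rw [hc, dotProduct_smul, mem_Q5_iff.1 hz, smul_eq_mul, mul_one] at h1
  rw [hc, h1, zero_smul]

lemma dhopf_snd_eq_zero {z ξ : R3 × R3} (hz : z ∈ Q5) (h1 : ξ.2 ⬝ᵥ z.1 = 0)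
    (h : (dhopf z ξ).2 = 0) : ξ.2 = 0 := by
  obtain ⟨-, e1⟩ := index_hopf_ne_zero (fst_ne_zero_of_mem_Q5 hz) (snd_ne_zero_of_mem_Q5 hz)
  obtain ⟨c, hc⟩ : ∃ c : ℝ, ξ.2 = c • z.2 := ⟨_, homChartDeriv_eq_zero e1 h⟩
  rw [hc, smul_dotProduct, mem_Q5_iff.1 hz, smul_eq_mul, mul_one] at h1
  rw [hc, h1, zero_smul]

lemma hasDerivAt_dotProduct {a b : ℝ → R3} {a' b' : R3} {t : ℝ} (ha : HasDerivAt a a' t)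
    (hb : HasDerivAt b b' t) : HasDerivAt (fun s => a s ⬝ᵥ b s) (a' ⬝ᵥ b t + a t ⬝ᵥ b') t := by
  simp only [dotProduct_fin3]
  have ha1 := hasDerivAt_pi.1 ha
  have hb1 := hasDerivAt_pi.1 hb
  refine ((((ha1 0).mul (hb1 0)).add ((ha1 1).mul (hb1 1))).add
    ((ha1 2).mul (hb1 2))).congr_deriv ?_
  ring

lemma hasDerivAt_crossProduct {a b : ℝ → R3} {a' b' : R3} {t : ℝ} (ha : HasDerivAt a a' t)
    (hb : HasDerivAt b b' t) : HasDerivAt (fun s => crossProduct (a s) (b s))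
      (crossProduct a' (b t) + crossProduct (a t) b') t := by
  have ha1 := hasDerivAt_pi.1 ha
  have hb1 := hasDerivAt_pi.1 hb
  rw [hasDerivAt_pi]
  intro k
  fin_cases k
  · refine (((ha1 1).mul (hb1 2)).sub ((ha1 2).mul (hb1 1))).congr_deriv ?_
    simp [cross_apply]
    ring
  · refine (((ha1 2).mul (hb1 0)).sub ((ha1 0).mul (hb1 2))).congr_deriv ?_
    simp [cross_apply]
    ring
  · refine (((ha1 0).mul (hb1 1)).sub ((ha1 1).mul (hb1 0))).congr_deriv ?_
    simp [cross_apply]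
    ring

lemma contDiffAt_crossProduct {a b : ℝ → R3} {t : ℝ} {n : WithTop ℕ∞} (ha : ContDiffAt ℝ n a t)
    (hb : ContDiffAt ℝ n b t) : ContDiffAt ℝ n (fun s => crossProduct (a s) (b s)) t := by
  have ha1 := contDiffAt_pi.1 ha
  have hb1 := contDiffAt_pi.1 hb
  refine contDiffAt_pi.2 fun k => ?_
  fin_cases k
  · exact ((ha1 1).mul (hb1 2)).sub ((ha1 2).mul (hb1 1))
  · exact ((ha1 2).mul (hb1 0)).sub ((ha1 0).mul (hb1 2))
  · exact ((ha1 0).mul (hb1 1)).sub ((ha1 1).mul (hb1 0))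

/-- The field of self-dual planes along the projection of an integral curve is parallel. -/
lemma isParallelAlong_sdPlane {ρ : RP2 × RP2 → ℝ} (hρ : ContMDiffOn I4 𝓘(ℝ, ℝ) ∞ ρ M4)
    (hρ_pos : ∀ m ∈ M4, 0 < ρ m) {J : Set ℝ} (hJ : IsOpen J) {γ : ℝ → R3 × R3}
    (hγ : IsIntegralCurveD γ J) :
    IsParallelAlong I4 (conformalMetric ρ) (hopf ∘ γ) (fun t => sdPlane (γ t)) J := by
  have hγd : ∀ t ∈ J, HasDerivAt γ (deriv γ t) t := fun t ht =>
    ((hγ.smooth.contDiffAt (hJ.mem_nhds ht)).differentiableAt (by simp)).hasDerivAt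
  refine ⟨fun t ht w hw => ?_, fun V hV t ht => ?_⟩
  · obtain ⟨ξ₀, hξ₀, rfl⟩ := mem_sdPlane.1 hw
    obtain ⟨e1, e2⟩ := mem_distD_iff.1 hξ₀
    set α : ℝ → R3 := fun s => ξ₀.1 - ((γ s).2 ⬝ᵥ ξ₀.1) • (γ s).1 with hα
    set ξ : ℝ → R3 × R3 := fun s => (α s, crossProduct (γ s).1 (α s)) with hξ
    have hd : ∀ s ∈ J, ξ s ∈ distD (γ s) := fun s hs => by
      refine mem_distD_iff.2 ⟨?_, rfl⟩
      simp only [hξ, hα, dotProduct_sub, dotProduct_smul, mem_Q5_iff.1 (hγ.mem s hs), smul_eq_mul]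
      ring
    have hξs : ContDiffOn ℝ ∞ ξ J := fun s hs => by
      have h := hγ.smooth.contDiffAt (hJ.mem_nhds hs)
      have hαs : ContDiffAt ℝ ∞ α s :=
        contDiffAt_const.sub ((contDiffAt_dotProduct h.snd contDiffAt_const).smul h.fst)
      exact (hαs.prodMk (contDiffAt_crossProduct h.fst hαs)).contDiffWithinAt
    refine ⟨fun s => dhopf (γ s) (ξ s), ⟨?_, fun s hs => ?_⟩, ?_⟩
    · exact isSmoothAlong_of_dhopf hJ _ (fun _ _ => rfl) hγ.smooth hξs hγ.mem fun _ _ => rfl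
    · exact mem_sdPlane.2 ⟨_, hd s hs, rfl⟩
    · have : ξ t = ξ₀ := by
        have h1 : α t = ξ₀.1 := by simp only [hα, e1, zero_smul, sub_zero]
        exact Prod.ext h1 (by rw [e2, ← h1])
      exact congrArg (dhopf (γ t)) this
  · have hQ := hγ.mem t ht
    have hz1 := fst_ne_zero_of_mem_Q5 hQ
    have hz2 := snd_ne_zero_of_mem_Q5 hQ
    obtain ⟨h1, h2⟩ := index_hopf_ne_zero hz1 hz2
    set i := RP2.index (hopf (γ t)).1 with hi
    set j := RP2.index (hopf (γ t)).2 with hj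
    have hvd : DifferentiableAt ℝ (localVectorField I4 (hopf ∘ γ) V (hopf (γ t))) t :=
      differentiableAt_localVectorField hJ hV.1 ht
    set v : ℝ → R2 × R2 := localVectorField I4 (hopf ∘ γ) V (hopf (γ t)) with hv
    set ξ : ℝ → R3 × R3 := fun s => horizontalPart (γ s) (affineLift i j (γ s) (v s)) with hξ
    have hγt := (hγd t ht).differentiableAt
    have hξd : DifferentiableAt ℝ ξ t :=
      differentiableAt_horizontalPart hγt (differentiableAt_affineLift hγt hvd)
    have hne := eventually_coord_ne_zero hγt.continuousAt h1 h2
    have hVξ : ∀ᶠ s in 𝓝 t, (V s : R2 × R2) = dhopf (γ s) (ξ s) ∧ ξ s ∈ distD (γ s) := by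
      filter_upwards [hJ.mem_nhds ht, hne] with s hs hs'
      obtain ⟨ζ, hζ, hVs⟩ := mem_sdPlane.1 (hV.2 s hs)
      have hvs : v s = hopfChartDeriv i j (γ s) ζ := by
        refine Eq.trans ?_ (mfderiv_extChartAt_dhopf rfl hs'.1 hs'.2 ζ)
        exact congrArg (mfderiv I4 𝓘(ℝ, R2 × R2) (extChartAt I4 (hopf (γ t))) (hopf (γ s)) :
          R2 × R2 →L[ℝ] R2 × R2) hVs.symm
      have e : ξ s = ζ := by
        rw [← horizontalPart_of_mem_distD hζ]
        refine horizontalPart_eq_of_hopfChartDeriv_eq (hγ.mem s hs) hs'.1 hs'.2 ?_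
        rw [hopfChartDeriv_affineLift hs'.1 hs'.2, hvs]
      rw [e]
      exact ⟨hVs.symm, hζ⟩
    have hγ'D := hγ.tangent t ht
    have hξD := hVξ.self_of_nhds.2
    obtain ⟨g1, g2⟩ := mem_distD_iff.1 hγ'D
    obtain ⟨x1, x2⟩ := mem_distD_iff.1 hξD
    obtain ⟨k, l, hkl⟩ := covariantDeriv_eq_dhopf hρ hρ_pos V Filter.EventuallyEq.rfl (hγd t ht)
      hξd.hasDerivAt (hVξ.mono fun _ h => h.1) hQ hγ'D.1 x1 (snd_dot_of_mem_distD hξD)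
      (by rw [horizontalPart_of_mem_distD hγ'D, horizontalPart_of_mem_distD hξD,
        flatMetric_distD hγ'D hξD])
    have hmem : ∀ ζ ∈ distD (γ t), dhopf (γ t) ζ ∈ sdPlane (γ t) := fun ζ hζ =>
      mem_sdPlane.2 ⟨ζ, hζ, rfl⟩
    have hgoal : (covariantDeriv I4 (conformalMetric ρ) (hopf ∘ γ) V t : R2 × R2) ∈
        sdPlane (γ t) := by
      rw [hkl, g1, zero_smul, zero_smul, sub_zero, add_zero]
      refine add_mem ?_ (add_mem (Submodule.smul_mem _ _ (hmem _ hγ'D))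
        (Submodule.smul_mem _ _ (hmem _ hξD)))
      rw [← dhopf_horizontalPart hQ]
      refine hmem _ (mem_distD_iff.2 ⟨(horizontalPart_idem hQ _).1, ?_⟩)
      have hder : (deriv ξ t).2 = crossProduct (deriv γ t).1 (ξ t).1 +
          crossProduct (γ t).1 (deriv ξ t).1 := by
        have e1 := hasDerivAt_crossProduct (hγd t ht).fst hξd.hasDerivAt.fst
        have e2 : (fun s => (ξ s).2) =ᶠ[𝓝 t] fun s => crossProduct (γ s).1 (ξ s).1 :=
          hVξ.mono fun _ h => (mem_distD_iff.1 h.2).2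
        exact (hasDerivAt_prod_snd hξd.hasDerivAt).unique (e1.congr_of_eventuallyEq e2)
      have hpar : crossProduct (deriv γ t).1 (ξ t).1 =
          (crossProduct (deriv γ t).1 (ξ t).1 ⬝ᵥ (γ t).1) • (γ t).2 :=
        cross_eq_smul_of_orthogonal hQ g1 x1
      rw [horizontalPart_apply]
      simp only [hder, add_dotProduct, cross_dot_left, add_zero, map_sub, map_smul, cross_self,
        smul_zero, sub_zero]
      nth_rewrite 1 [hpar]
      abel
    exact hgoal

/-- The projection of a regular integral curve. -/
lemma isHalfGeodesic_hopf {ρ : RP2 × RP2 → ℝ} (hρ : ContMDiffOn I4 𝓘(ℝ, ℝ) ∞ ρ M4)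
    (hρ_pos : ∀ m ∈ M4, 0 < ρ m) {J : Set ℝ} (hJ : IsOpen J) {γ : ℝ → R3 × R3}
    (hγ : IsIntegralCurveD γ J) (hreg : ∀ t ∈ J, deriv γ t ≠ 0) :
    IsHalfGeodesic (conformalMetric ρ) (hopf ∘ γ) J := by
  have hsm : ∀ t ∈ J, ContMDiffAt 𝓘(ℝ, ℝ) I4 ∞ (hopf ∘ γ) t := fun t ht =>
    (contMDiffAt_hopf (fst_ne_zero_of_mem_Q5 (hγ.mem t ht))
      (snd_ne_zero_of_mem_Q5 (hγ.mem t ht))).comp t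
      (hγ.smooth.contDiffAt (hJ.mem_nhds ht)).contMDiffAt
  have hvel : ∀ t ∈ J, velocity I4 (hopf ∘ γ) t = dhopf (γ t) (deriv γ t) := fun t ht =>
    velocity_eq_dhopf Filter.EventuallyEq.rfl
      ((hγ.smooth.contDiffAt (hJ.mem_nhds ht)).differentiableAt (by simp)).hasDerivAt
      (fst_ne_zero_of_mem_Q5 (hγ.mem t ht)) (snd_ne_zero_of_mem_Q5 (hγ.mem t ht))
  have hvmem : ∀ t ∈ J, velocity I4 (hopf ∘ γ) t ∈ sdPlane (γ t) := fun t ht =>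
    mem_sdPlane.2 ⟨_, hγ.tangent t ht, (hvel t ht).symm⟩
  have hSD : ∀ t ∈ J, IsSDNullPlane (conformalMetric ρ) ((hopf ∘ γ) t) (sdPlane (γ t)) :=
    fun t ht => isSDNullPlane_sdPlane (hγ.mem t ht) (hρ_pos _ (hopf_mem_M4 (hγ.mem t ht)))
  refine ⟨⟨fun t ht => (hsm t ht).contMDiffWithinAt, fun t ht => hopf_mem_M4 (hγ.mem t ht)⟩,
    fun t ht => ⟨?_, ?_⟩, fun t ht => (hSD t ht).1 _ (hvmem t ht), ⟨fun t => sdPlane (γ t),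
      fun t ht => ⟨hSD t ht, hvmem t ht⟩, isParallelAlong_sdPlane hρ hρ_pos hJ hγ⟩⟩
  · rw [velocity_fst ((hsm t ht).mdifferentiableAt (by simp)), hvel t ht]
    exact fun h => fst_ne_zero_of_mem_distD (hγ.tangent t ht) (hreg t ht)
      (dhopf_fst_eq_zero (hγ.mem t ht) (mem_distD_iff.1 (hγ.tangent t ht)).1 h)
  · rw [velocity_snd ((hsm t ht).mdifferentiableAt (by simp)), hvel t ht]
    exact fun h => snd_ne_zero_of_mem_distD (hγ.mem t ht) (hγ.tangent t ht) (hreg t ht)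
      (dhopf_snd_eq_zero (hγ.mem t ht) (snd_dot_of_mem_distD (hγ.tangent t ht)) h)

/-- Integral curves with the same projection coincide. -/
lemma integralCurve_eq_of_hopf_eq {γ₁ γ₂ : ℝ → R3 × R3} {U : Set ℝ} (hU : IsOpen U)
    (h1 : IsIntegralCurveD γ₁ U) (h2 : IsIntegralCurveD γ₂ U)
    (h : ∀ t ∈ U, hopf (γ₂ t) = hopf (γ₁ t)) {t : ℝ} (ht : t ∈ U) (hreg : deriv γ₁ t ≠ 0) :
    γ₂ t = γ₁ t := by
  have hd1 := ((h1.smooth.contDiffAt (hU.mem_nhds ht)).differentiableAt (by simp)).hasDerivAt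
  have hd2 := ((h2.smooth.contDiffAt (hU.mem_nhds ht)).differentiableAt (by simp)).hasDerivAt
  set c : ℝ → ℝ := fun s => (γ₁ s).2 ⬝ᵥ (γ₂ s).1 with hc
  have hrel : ∀ s ∈ U, (γ₂ s).1 = c s • (γ₁ s).1 ∧ (γ₁ s).2 = c s • (γ₂ s).2 := by
    intro s hs
    have q1 := mem_Q5_iff.1 (h1.mem s hs)
    have q2 := mem_Q5_iff.1 (h2.mem s hs)
    obtain ⟨a, ha⟩ := RP2.exists_smul_of_ofCoords_eq (fst_ne_zero_of_mem_Q5 (h1.mem s hs))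
      (fst_ne_zero_of_mem_Q5 (h2.mem s hs)) (congrArg Prod.fst (h s hs))
    obtain ⟨b, hb⟩ := RP2.exists_smul_of_ofCoords_eq (snd_ne_zero_of_mem_Q5 (h2.mem s hs))
      (snd_ne_zero_of_mem_Q5 (h1.mem s hs)) (congrArg Prod.snd (h s hs).symm)
    have hca : c s = a := by simp only [hc, ha, dotProduct_smul, q1, smul_eq_mul, mul_one]
    have hcb : c s = b := by simp only [hc, hb, smul_dotProduct, q2, smul_eq_mul, mul_one]
    exact ⟨by rw [hca, ha], by rw [hcb, hb]⟩
  have hcd := hasDerivAt_dotProduct (hasDerivAt_prod_snd hd1) (hasDerivAt_prod_fst hd2)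
  obtain ⟨t1, t2⟩ := mem_distD_iff.1 (h1.tangent t ht)
  obtain ⟨s1, s2⟩ := mem_distD_iff.1 (h2.tangent t ht)
  have hc' : HasDerivAt c 0 t := by
    refine hcd.congr_deriv ?_
    rw [(hrel t ht).1, (hrel t ht).2, dotProduct_smul, smul_dotProduct, s1,
      snd_dot_of_mem_distD (h1.tangent t ht), smul_zero, add_zero]
  have e1 : (deriv γ₂ t).1 = c t • (deriv γ₁ t).1 := by
    have e := (hc'.smul (hasDerivAt_prod_fst hd1)).congr_of_eventuallyEq
      (f₁ := fun s => (γ₂ s).1) (by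
        filter_upwards [hU.mem_nhds ht] with s hs
        exact (hrel s hs).1)
    rw [(hasDerivAt_prod_fst hd2).unique e, zero_smul, add_zero]
  have e2 : (deriv γ₁ t).2 = c t • (deriv γ₂ t).2 := by
    have e := (hc'.smul (hasDerivAt_prod_snd hd2)).congr_of_eventuallyEq
      (f₁ := fun s => (γ₁ s).2) (by
        filter_upwards [hU.mem_nhds ht] with s hs
        exact (hrel s hs).2)
    rw [(hasDerivAt_prod_snd hd1).unique e, zero_smul, add_zero]
  have e3 : (deriv γ₁ t).2 = (c t ^ 3) • (deriv γ₁ t).2 := by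
    conv_lhs => rw [e2, s2, (hrel t ht).1, e1]
    rw [t2]
    simp only [map_smul, LinearMap.smul_apply, smul_smul]
    congr 1
    ring
  have hne := snd_ne_zero_of_mem_distD (h1.mem t ht) (h1.tangent t ht) hreg
  have hc3 : c t ^ 3 = 1 := by
    have : (c t ^ 3 - 1) • (deriv γ₁ t).2 = 0 := by
      rw [sub_smul, one_smul, ← e3, sub_self]
    exact sub_eq_zero.1 ((smul_eq_zero.1 this).resolve_right hne)
  have hc1 : c t = 1 := by
    have h0 : (c t - 1) * (c t ^ 2 + c t + 1) = 0 := by linear_combination hc3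
    exact sub_eq_zero.1 ((mul_eq_zero.1 h0).resolve_right (by nlinarith [sq_nonneg (c t + 1)]))
  obtain ⟨r1, r2⟩ := hrel t ht
  rw [hc1, one_smul] at r1 r2
  exact Prod.ext r1 r2.symm

/-! ## Lifting half-geodesics -/

lemma exists_lift_Q5 {Γ : ℝ → RP2 × RP2} {J : Set ℝ} (hJ : IsOpen J) (hΓ : IsCurveInM4 Γ J)
    {t₀ : ℝ} (ht₀ : t₀ ∈ J) : ∃ (U : Set ℝ) (z : ℝ → R3 × R3), IsOpen U ∧ t₀ ∈ U ∧ U ⊆ J ∧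
      ContDiffOn ℝ ∞ z U ∧ (∀ t ∈ U, z t ∈ Q5) ∧ ∀ t ∈ U, hopf (z t) = Γ t := by
  set m := Γ t₀ with hm
  set i := RP2.index m.1 with hi
  set j := RP2.index m.2 with hj
  set U := J ∩ Γ ⁻¹' (extChartAt I4 m).source with hU
  have hUo : IsOpen U := hΓ.smooth.continuousOn.isOpen_inter_preimage hJ
    (isOpen_extChartAt_source (I := I4) m)
  set x : ℝ → R2 × R2 := fun t => extChartAt I4 m (Γ t) with hx
  have hxs : ContDiffOn ℝ ∞ x U := by
    rw [← contMDiffOn_iff_contDiffOn]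
    refine (contMDiffOn_extChartAt (I := I4) (n := ∞) (x := m)).comp
      (hΓ.smooth.mono inter_subset_left) ?_
    intro t ht
    have := ht.2
    rwa [mem_preimage, extChartAt_source] at this
  have hF : ∀ t ∈ U, affinePairing i j (x t) ≠ 0 ∧ hopf (affinePt i (x t).1, affinePt j (x t).2) =
      Γ t := by
    intro t ht
    have e := (extChartAt I4 m).left_inv ht.2
    rw [extChartAt_symm_apply_I4] at e
    refine ⟨?_, e⟩
    have hM := hΓ.mem t ht.1
    rw [← e, hopf_mem_M4_iff (affinePt_ne_zero _ _) (affinePt_ne_zero _ _)] at hM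
    exact hM
  refine ⟨U, fun t => affineSection i j (x t), hUo, ⟨ht₀, mem_extChartAt_source (I := I4) m⟩,
    inter_subset_left, fun t ht => ?_, fun t ht => affineSection_mem_Q5 (hF t ht).1,
    fun t ht => ?_⟩
  · have hxt := hxs.contDiffAt (hUo.mem_nhds ht)
    have hA : ContDiffAt ℝ ∞ (fun t => affinePt i (x t).1) t :=
      (contDiff_affinePt i).contDiffAt.comp t hxt.fst
    have hB : ContDiffAt ℝ ∞ (fun t => affinePt j (x t).2) t :=
      (contDiff_affinePt j).contDiffAt.comp t hxt.snd
    have hP : ContDiffAt ℝ ∞ (fun t => affinePairing i j (x t)) t :=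
      (contDiff_affinePairing i j).contDiffAt.comp t hxt
    exact (hA.prodMk ((hP.inv (hF t ht).1).smul hB)).contDiffWithinAt
  · rw [hopf_affineSection (hF t ht).1]
    exact (extChartAt I4 m).left_inv ht.2

lemma velocity_eq_dhopf_of_lift {Γ : ℝ → RP2 × RP2} {U : Set ℝ} (hU : IsOpen U)
    {z : ℝ → R3 × R3} (hz : ContDiffOn ℝ ∞ z U) (hQ : ∀ t ∈ U, z t ∈ Q5)
    (hΓ : ∀ t ∈ U, hopf (z t) = Γ t) {t : ℝ} (ht : t ∈ U) :
    velocity I4 Γ t = dhopf (z t) (deriv z t) := by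
  refine velocity_eq_dhopf ?_
    ((hz.contDiffAt (hU.mem_nhds ht)).differentiableAt (by simp)).hasDerivAt
    (fst_ne_zero_of_mem_Q5 (hQ t ht)) (snd_ne_zero_of_mem_Q5 (hQ t ht))
  filter_upwards [hU.mem_nhds ht] with s hs
  exact (hΓ s hs).symm

lemma contDiffOn_deriv_of_isOpen {z : ℝ → R3 × R3} {U : Set ℝ} (hU : IsOpen U)
    (hz : ContDiffOn ℝ ∞ z U) : ContDiffOn ℝ ∞ (deriv z) U :=
  ((contDiffOn_infty_iff_deriv_of_isOpen hU).1 hz).2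

lemma isSmoothAlong_velocity {Γ : ℝ → RP2 × RP2} {J : Set ℝ} (hJ : IsOpen J)
    (hΓ : IsCurveInM4 Γ J) : IsSmoothAlong I4 Γ (velocity I4 Γ) J := by
  intro t ht
  obtain ⟨U, z, hU, htU, -, hz, hQ, hzΓ⟩ := exists_lift_Q5 hJ hΓ ht
  have h := isSmoothAlong_of_dhopf hU (velocity I4 Γ) (fun s hs => (hzΓ s hs).symm) hz
    (contDiffOn_deriv_of_isOpen hU hz) hQ
    fun s hs => velocity_eq_dhopf_of_lift hU hz hQ hzΓ hs
  exact (h.contMDiffAt (hU.mem_nhds htU)).contMDiffWithinAt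

lemma deriv_dot_of_mem_Q5 {z : ℝ → R3 × R3} {z' : R3 × R3} {t : ℝ} (hz : HasDerivAt z z' t)
    (hQ : ∀ᶠ s in 𝓝 t, z s ∈ Q5) : z'.2 ⬝ᵥ (z t).1 + (z t).2 ⬝ᵥ z'.1 = 0 := by
  have h := hasDerivAt_dotProduct (hasDerivAt_prod_snd hz) (hasDerivAt_prod_fst hz)
  have h2 : (fun s => (z s).2 ⬝ᵥ (z s).1) =ᶠ[𝓝 t] fun _ => (1 : ℝ) := hQ
  exact h.unique ((hasDerivAt_const t (1 : ℝ)).congr_of_eventuallyEq h2)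

/-- A lift of a half-geodesic to `Q⁵` whose horizontal velocity is in the distribution is
horizontal. -/
lemma dot_deriv_eq_zero_of_isHalfGeodesic {ρ : RP2 × RP2 → ℝ}
    (hρ : ContMDiffOn I4 𝓘(ℝ, ℝ) ∞ ρ M4) (hρ_pos : ∀ m ∈ M4, 0 < ρ m) {J U : Set ℝ}
    (hJ : IsOpen J) {Γ : ℝ → RP2 × RP2} (hΓ : IsHalfGeodesic (conformalMetric ρ) Γ J)
    (hU : IsOpen U) (hUJ : U ⊆ J) {γ : ℝ → R3 × R3} (hγ : ContDiffOn ℝ ∞ γ U)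
    (hQ : ∀ t ∈ U, γ t ∈ Q5) (hγΓ : ∀ t ∈ U, hopf (γ t) = Γ t)
    (hhor : ∀ t ∈ U, horizontalPart (γ t) (deriv γ t) ∈ distD (γ t))
    (hne : ∀ t ∈ U, horizontalPart (γ t) (deriv γ t) ≠ 0) {t : ℝ} (ht : t ∈ U) :
    (γ t).2 ⬝ᵥ (deriv γ t).1 = 0 := by
  obtain ⟨W, hW, hWpar⟩ := hΓ.parallel
  have htJ := hUJ ht
  have hmem := hWpar.parallel (velocity I4 Γ)
    ⟨isSmoothAlong_velocity hJ hΓ.curve, fun s hs => (hW s hs).2⟩ t htJ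
  set ξ : ℝ → R3 × R3 := fun s => horizontalPart (γ s) (deriv γ s) with hξ
  have hγd := ((hγ.contDiffAt (hU.mem_nhds ht)).differentiableAt (by simp)).hasDerivAt
  have hξd : DifferentiableAt ℝ ξ t := differentiableAt_horizontalPart hγd.differentiableAt
    (((contDiffOn_deriv_of_isOpen hU hγ).contDiffAt (hU.mem_nhds ht)).differentiableAt (by simp))
  have hvel : ∀ s ∈ U, (velocity I4 Γ s : R2 × R2) = dhopf (γ s) (ξ s) := fun s hs =>
    (velocity_eq_dhopf_of_lift hU hγ hQ hγΓ hs).trans (dhopf_horizontalPart (hQ s hs) _).symm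
  have hξD : ξ t ∈ distD (γ t) := hhor t ht
  obtain ⟨x1, x2⟩ := mem_distD_iff.1 hξD
  have x3 := snd_dot_of_mem_distD hξD
  have hγ' := deriv_dot_of_mem_Q5 hγd (by
    filter_upwards [hU.mem_nhds ht] with s hs
    exact hQ s hs)
  obtain ⟨k, l, hkl⟩ := covariantDeriv_eq_dhopf hρ hρ_pos (velocity I4 Γ)
    (by
      filter_upwards [hU.mem_nhds ht] with s hs
      exact (hγΓ s hs).symm) hγd hξd.hasDerivAt
    (by
      filter_upwards [hU.mem_nhds ht] with s hs
      exact hvel s hs) (hQ t ht) hγ' x1 x3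
    (by rw [horizontalPart_of_mem_distD hξD]; exact flatMetric_distD hξD hξD)
  have hD := mem_sdPlane_of_isSDNullPlane (hQ t ht) (hγΓ t ht).symm
    (hρ_pos _ (hΓ.curve.mem t htJ)) (hW t htJ).1 hξD
    (fst_ne_zero_of_mem_distD hξD (hne t ht))
    (by
      have := (hW t htJ).2
      rw [hvel t ht] at this
      exact this) hmem
  have hVmem : dhopf (γ t) (ξ t) ∈ sdPlane (γ t) := mem_sdPlane.2 ⟨_, hξD, rfl⟩
  have hVeq : dhopf (γ t) (deriv γ t) = dhopf (γ t) (ξ t) :=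
    (dhopf_horizontalPart (hQ t ht) _).symm
  set κ := (γ t).2 ⬝ᵥ (deriv γ t).1 with hκ
  rw [hkl, hVeq, Submodule.add_mem_iff_left _ (add_mem (Submodule.smul_mem _ _ hVmem)
    (Submodule.smul_mem _ _ hVmem))] at hD
  obtain ⟨η, hη, hηeq⟩ := mem_sdPlane.1 hD
  have hηh := horizontalPart_eq_of_dhopf_eq (hQ t ht) hηeq
  rw [horizontalPart_of_mem_distD hη] at hηh
  have hrel := (mem_distD_iff.1 hη).2
  have hq' : (deriv γ t).1 = (ξ t).1 + κ • (γ t).1 := by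
    simp only [hξ, horizontalPart_apply, ← hκ, sub_add_cancel]
  have hder : (deriv ξ t).2 = κ • (ξ t).2 + crossProduct (γ t).1 (deriv ξ t).1 := by
    have e1 := hasDerivAt_crossProduct (hasDerivAt_prod_fst hγd)
      (hasDerivAt_prod_fst hξd.hasDerivAt)
    have e2 : (fun s => (ξ s).2) =ᶠ[𝓝 t] fun s => crossProduct (γ s).1 (ξ s).1 := by
      filter_upwards [hU.mem_nhds ht] with s hs
      exact (mem_distD_iff.1 (hhor s hs)).2
    rw [(hasDerivAt_prod_snd hξd.hasDerivAt).unique (e1.congr_of_eventuallyEq e2), hq', x2]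
    simp only [map_add, map_smul, LinearMap.add_apply, LinearMap.smul_apply, cross_self, zero_add]
  rw [hηh, horizontalPart_apply] at hrel
  simp only [hder, add_dotProduct, smul_dotProduct, x3, cross_dot_left, smul_zero, add_zero,
    zero_smul, sub_zero, map_sub, map_smul, cross_self, ← x2] at hrel
  have h3 : (3 * κ) • (ξ t).2 = 0 := by
    have : κ • (ξ t).2 + κ • (ξ t).2 + κ • (ξ t).2 = 0 := by
      have e := sub_eq_zero.2 hrel
      rw [← e]
      abel
    rw [← this]
    module
  have h4 := (smul_eq_zero.1 h3).resolve_right (snd_ne_zero_of_mem_distD (hQ t ht) hξD (hne t ht))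
  linarith

lemma eq_smul_cross_of_orthogonal {q α β : R3} (hq : β ⬝ᵥ q = 0) (hα : β ⬝ᵥ α = 0)
    (hN : crossProduct q α ≠ 0) :
    β = ((β ⬝ᵥ crossProduct q α) / (crossProduct q α ⬝ᵥ crossProduct q α)) •
      crossProduct q α := by
  have hN2 : crossProduct q α ⬝ᵥ crossProduct q α ≠ 0 := fun h =>
    hN (eq_zero_of_dotProduct_self_eq_zero h)
  have key : (crossProduct q α ⬝ᵥ crossProduct q α) • β =
      (β ⬝ᵥ crossProduct q α) • crossProduct q α := by
    rw [dotProduct_fin3] at hq hα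
    simp only [cross_apply, dotProduct_fin3, Matrix.cons_val_zero, Matrix.cons_val_one,
      Matrix.cons_val]
    funext k
    fin_cases k <;> simp only [Pi.smul_apply, smul_eq_mul, Fin.zero_eta, Fin.mk_one,
      Fin.reduceFinMk, Matrix.cons_val_zero, Matrix.cons_val_one, Matrix.cons_val]
    · linear_combination (α 1 * (q 0 * α 1 - q 1 * α 0) - α 2 * (q 2 * α 0 - q 0 * α 2)) * hq +
        (q 2 * (q 2 * α 0 - q 0 * α 2) - q 1 * (q 0 * α 1 - q 1 * α 0)) * hα
    · linear_combination (α 2 * (q 1 * α 2 - q 2 * α 1) - α 0 * (q 0 * α 1 - q 1 * α 0)) * hq +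
        (q 0 * (q 0 * α 1 - q 1 * α 0) - q 2 * (q 1 * α 2 - q 2 * α 1)) * hα
    · linear_combination (α 0 * (q 2 * α 0 - q 0 * α 2) - α 1 * (q 1 * α 2 - q 2 * α 1)) * hq +
        (q 1 * (q 1 * α 2 - q 2 * α 1) - q 0 * (q 2 * α 0 - q 0 * α 2)) * hα
  rw [div_eq_inv_mul, mul_smul, ← key, smul_smul, inv_mul_cancel₀ hN2, one_smul]

/-- A smooth cube root of a nonvanishing smooth function. -/
lemma exists_cube_root {μ : ℝ → ℝ} {U : Set ℝ} (hμ : ContDiffOn ℝ ∞ μ U) (h0 : ∀ t ∈ U, μ t ≠ 0) :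
    ∃ c : ℝ → ℝ, ContDiffOn ℝ ∞ c U ∧ ∀ t ∈ U, c t ^ 3 = μ t := by
  refine ⟨fun t => μ t * (μ t ^ 2) ^ (-(1 / 3) : ℝ), ?_, fun t ht => ?_⟩
  · exact hμ.mul ((hμ.pow 2).rpow_const_of_ne fun t ht => pow_ne_zero 2 (h0 t ht))
  · have hp : 0 < μ t ^ 2 := by have := h0 t ht; positivity
    have : ((μ t ^ 2) ^ (-(1 / 3) : ℝ)) ^ 3 = (μ t ^ 2)⁻¹ := by
      rw [← Real.rpow_natCast, ← Real.rpow_mul hp.le, ← Real.rpow_neg_one]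
      norm_num
    rw [mul_pow, this]
    have := h0 t ht
    field_simp

lemma exists_local_integralCurve {ρ : RP2 × RP2 → ℝ}
    (hρ : ContMDiffOn I4 𝓘(ℝ, ℝ) ∞ ρ M4) (hρ_pos : ∀ m ∈ M4, 0 < ρ m) {J : Set ℝ}
    (hJ : IsOpen J) {Γ : ℝ → RP2 × RP2} (hΓ : IsHalfGeodesic (conformalMetric ρ) Γ J)
    {t₀ : ℝ} (ht₀ : t₀ ∈ J) : ∃ (U : Set ℝ) (γ : ℝ → R3 × R3), IsOpen U ∧ t₀ ∈ U ∧ U ⊆ J ∧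
      IsIntegralCurveD γ U ∧ (∀ t ∈ U, deriv γ t ≠ 0) ∧ ∀ t ∈ U, hopf (γ t) = Γ t := by
  obtain ⟨U, z, hU, htU, hUJ, hz, hQ, hzΓ⟩ := exists_lift_Q5 hJ hΓ.curve ht₀
  have hzd : ∀ t ∈ U, HasDerivAt z (deriv z t) t := fun t ht =>
    ((hz.contDiffAt (hU.mem_nhds ht)).differentiableAt (by simp)).hasDerivAt
  have hz' := contDiffOn_deriv_of_isOpen hU hz
  set ξ : ℝ → R3 × R3 := fun t => horizontalPart (z t) (deriv z t) with hξ
  have hξs : ContDiffOn ℝ ∞ ξ U := fun t ht => by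
    have h1 := hz.contDiffAt (hU.mem_nhds ht)
    have h2 := hz'.contDiffAt (hU.mem_nhds ht)
    exact ((h2.fst.sub ((contDiffAt_dotProduct h1.snd h2.fst).smul h1.fst)).prodMk
      (h2.snd.sub ((contDiffAt_dotProduct h2.snd h1.fst).smul h1.snd))).contDiffWithinAt
  have hhor : ∀ t ∈ U, (z t).2 ⬝ᵥ (ξ t).1 = 0 ∧ (ξ t).2 ⬝ᵥ (z t).1 = 0 := fun t ht =>
    horizontalPart_idem (hQ t ht) _
  have hvel : ∀ t ∈ U, (velocity I4 Γ t : R2 × R2) = dhopf (z t) (ξ t) := fun t ht =>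
    (velocity_eq_dhopf_of_lift hU hz hQ hzΓ ht).trans (dhopf_horizontalPart (hQ t ht) _).symm
  have hmd : ∀ t ∈ U, MDifferentiableAt 𝓘(ℝ, ℝ) I4 Γ t := fun t ht =>
    ((hΓ.curve.smooth t (hUJ ht)).contMDiffAt (hJ.mem_nhds (hUJ ht))).mdifferentiableAt (by simp)
  have hξ1 : ∀ t ∈ U, (ξ t).1 ≠ 0 := fun t ht h => by
    refine (hΓ.nondegenerate t (hUJ ht)).1 ?_
    rw [velocity_fst (hmd t ht), hvel t ht]
    exact (congrArg (homChartDeriv _ (z t).1) h).trans (map_zero _)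
  have hξ2 : ∀ t ∈ U, (ξ t).2 ≠ 0 := fun t ht h => by
    refine (hΓ.nondegenerate t (hUJ ht)).2 ?_
    rw [velocity_snd (hmd t ht), hvel t ht]
    exact (congrArg (homChartDeriv _ (z t).2) h).trans (map_zero _)
  have hnull : ∀ t ∈ U, (ξ t).2 ⬝ᵥ (ξ t).1 = 0 := fun t ht => by
    have key : ∀ m : RP2 × RP2, m = hopf (z t) → ∀ v : TangentSpace I4 m,
        (v : R2 × R2) = dhopf (z t) (ξ t) → metricAt (conformalMetric ρ) m v v = 0 →
        (ξ t).2 ⬝ᵥ (ξ t).1 = 0 := by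
      rintro m rfl v hv h
      rw [hv, conformalMetric_dhopf ρ (hQ t ht),
        horizontalPart_eq_self (hhor t ht).1 (hhor t ht).2, flatMetric_apply] at h
      have := (mul_eq_zero.1 h).resolve_left (hρ_pos _ (hopf_mem_M4 (hQ t ht))).ne'
      linarith
    exact key _ (hzΓ t ht).symm _ (hvel t ht) (hΓ.null t (hUJ ht))
  set N : ℝ → R3 := fun t => crossProduct (z t).1 (ξ t).1 with hN
  have hN0 : ∀ t ∈ U, N t ≠ 0 := fun t ht h =>
    hξ1 t ht (eq_zero_of_cross_eq_zero (hQ t ht) (hhor t ht).1 h)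
  set μ : ℝ → ℝ := fun t => ((ξ t).2 ⬝ᵥ N t) / (N t ⬝ᵥ N t) with hμ
  have hβ : ∀ t ∈ U, (ξ t).2 = μ t • N t := fun t ht =>
    eq_smul_cross_of_orthogonal (hhor t ht).2 (hnull t ht) (hN0 t ht)
  have hμ0 : ∀ t ∈ U, μ t ≠ 0 := fun t ht h => hξ2 t ht (by rw [hβ t ht, h, zero_smul])
  have hμs : ContDiffOn ℝ ∞ μ U := fun t ht => by
    have h1 := hz.contDiffAt (hU.mem_nhds ht)
    have h2 := hξs.contDiffAt (hU.mem_nhds ht)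
    have h3 : ContDiffAt ℝ ∞ N t := contDiffAt_crossProduct h1.fst h2.fst
    exact ((contDiffAt_dotProduct h2.snd h3).div (contDiffAt_dotProduct h3 h3) fun h =>
      hN0 t ht (eq_zero_of_dotProduct_self_eq_zero h)).contDiffWithinAt
  obtain ⟨c, hcs, hc3⟩ := exists_cube_root hμs hμ0
  have hc0 : ∀ t ∈ U, c t ≠ 0 := fun t ht h => hμ0 t ht (by rw [← hc3 t ht, h]; norm_num)
  set γ : ℝ → R3 × R3 := fun t => (c t • (z t).1, (c t)⁻¹ • (z t).2) with hγ
  have hγs : ContDiffOn ℝ ∞ γ U := fun t ht => by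
    have h1 := hz.contDiffAt (hU.mem_nhds ht)
    have h2 := hcs.contDiffAt (hU.mem_nhds ht)
    exact ((h2.smul h1.fst).prodMk ((h2.inv (hc0 t ht)).smul h1.snd)).contDiffWithinAt
  have hγQ : ∀ t ∈ U, γ t ∈ Q5 := fun t ht => by
    rw [mem_Q5_iff]
    simp only [hγ, smul_dotProduct, dotProduct_smul, mem_Q5_iff.1 (hQ t ht), smul_eq_mul, mul_one]
    exact mul_inv_cancel₀ (hc0 t ht)
  have hγΓ : ∀ t ∈ U, hopf (γ t) = Γ t := fun t ht => by
    rw [← hzΓ t ht, hopf, hopf, RP2.ofCoords_smul (hc0 t ht) (fst_ne_zero_of_mem_Q5 (hQ t ht)),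
      RP2.ofCoords_smul (inv_ne_zero (hc0 t ht)) (snd_ne_zero_of_mem_Q5 (hQ t ht))]
  have hhorγ : ∀ t ∈ U, horizontalPart (γ t) (deriv γ t) = (c t • (ξ t).1, (c t)⁻¹ • (ξ t).2) := by
    intro t ht
    have hcd := ((hcs.contDiffAt (hU.mem_nhds ht)).differentiableAt (by simp)).hasDerivAt
    have hd := (hcd.smul (hasDerivAt_prod_fst (hzd t ht))).prodMk
      ((hcd.inv (hc0 t ht)).smul (hasDerivAt_prod_snd (hzd t ht)))
    have hd' : deriv γ t = _ := hd.deriv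
    have e := horizontalPart_rescale (hQ t ht) (inv_ne_zero (hc0 t ht)) (deriv c t)
      (-deriv c t / c t ^ 2) (deriv z t)
    rw [inv_inv] at e
    rw [hd']
    refine Eq.trans ?_ e
    rw [add_comm ((-deriv c t / c t ^ 2) • (z t).2)]
    rfl
  have hD : ∀ t ∈ U, horizontalPart (γ t) (deriv γ t) ∈ distD (γ t) := fun t ht => by
    rw [hhorγ t ht]
    refine mem_distD_iff.2 ⟨?_, ?_⟩
    · simp [hγ, (hhor t ht).1]
    · simp only [hγ, map_smul, LinearMap.smul_apply, smul_smul]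
      rw [hβ t ht, ← hc3 t ht, smul_smul]
      congr 1
      have := hc0 t ht
      field_simp
  have hne : ∀ t ∈ U, horizontalPart (γ t) (deriv γ t) ≠ 0 := fun t ht h => by
    rw [hhorγ t ht] at h
    exact smul_ne_zero (hc0 t ht) (hξ1 t ht) (congrArg Prod.fst h)
  have hself : ∀ t ∈ U, horizontalPart (γ t) (deriv γ t) = deriv γ t := fun t ht => by
    have h1 := dot_deriv_eq_zero_of_isHalfGeodesic hρ hρ_pos hJ hΓ hU hUJ hγs hγQ hγΓ hD hne ht
    have h2 := deriv_dot_of_mem_Q5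
      ((hγs.contDiffAt (hU.mem_nhds ht)).differentiableAt (by simp)).hasDerivAt (by
        filter_upwards [hU.mem_nhds ht] with s hs
        exact hγQ s hs)
    rw [h1, add_zero] at h2
    exact horizontalPart_eq_self h1 h2
  exact ⟨U, γ, hU, htU, hUJ, ⟨hγs, hγQ, fun t ht => hself t ht ▸ hD t ht⟩,
    fun t ht => hself t ht ▸ hne t ht, hγΓ⟩

lemma IsIntegralCurveD.mono {γ : ℝ → R3 × R3} {J U : Set ℝ} (h : IsIntegralCurveD γ J)
    (hU : U ⊆ J) : IsIntegralCurveD γ U :=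
  ⟨h.smooth.mono hU, fun t ht => h.mem t (hU ht), fun t ht => h.tangent t (hU ht)⟩

/-- A half-geodesic is the projection of exactly one integral curve, which is regular. -/
lemma exists_unique_integralCurve {ρ : RP2 × RP2 → ℝ}
    (hρ : ContMDiffOn I4 𝓘(ℝ, ℝ) ∞ ρ M4) (hρ_pos : ∀ m ∈ M4, 0 < ρ m) {J : Set ℝ}
    (hJ : IsOpen J) {Γ : ℝ → RP2 × RP2} (hΓ : IsHalfGeodesic (conformalMetric ρ) Γ J) :
    ∃ γ : ℝ → R3 × R3, IsIntegralCurveD γ J ∧ (∀ t ∈ J, deriv γ t ≠ 0) ∧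
      (∀ t ∈ J, hopf (γ t) = Γ t) ∧
      ∀ γ' : ℝ → R3 × R3, IsIntegralCurveD γ' J → (∀ t ∈ J, hopf (γ' t) = Γ t) →
        EqOn γ' γ J := by
  choose! U g hU htU hUJ hg hreg hgΓ using
    fun t (ht : t ∈ J) => exists_local_integralCurve hρ hρ_pos hJ hΓ ht
  have hev : ∀ t ∈ J, (fun s => g s s) =ᶠ[𝓝 t] g t := by
    intro t ht
    filter_upwards [(hU t ht).mem_nhds (htU t ht)] with s hs
    have hsJ := hUJ t ht hs
    exact integralCurve_eq_of_hopf_eq ((hU t ht).inter (hU s hsJ))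
      ((hg t ht).mono inter_subset_left) ((hg s hsJ).mono inter_subset_right)
      (fun r hr => (hgΓ s hsJ r hr.2).trans (hgΓ t ht r hr.1).symm) ⟨hs, htU s hsJ⟩
      (hreg t ht s hs)
  have hcurve : IsIntegralCurveD (fun s => g s s) J := by
    refine ⟨fun t ht => ?_, fun t ht => (hg t ht).mem t (htU t ht), fun t ht => ?_⟩
    · exact (((hg t ht).smooth.contDiffAt ((hU t ht).mem_nhds (htU t ht))).congr_of_eventuallyEq
        (hev t ht)).contDiffWithinAt
    · rw [(hev t ht).deriv_eq]
      exact (hg t ht).tangent t (htU t ht)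
  have hreg' : ∀ t ∈ J, deriv (fun s => g s s) t ≠ 0 := fun t ht => by
    rw [(hev t ht).deriv_eq]
    exact hreg t ht t (htU t ht)
  have hproj : ∀ t ∈ J, hopf (g t t) = Γ t := fun t ht => hgΓ t ht t (htU t ht)
  exact ⟨fun s => g s s, hcurve, hreg', hproj, fun γ' hγ' hγ'Γ t ht =>
    integralCurve_eq_of_hopf_eq hJ hcurve hγ'
      (fun r hr => (hγ'Γ r hr).trans (hproj r hr).symm) ht (hreg' t ht)⟩

theorem mainTheorem6
    (ρ : RP2 × RP2 → ℝ) (hρ : ContMDiffOn I4 𝓘(ℝ, ℝ) ∞ ρ M4) (hρ_pos : ∀ m ∈ M4, 0 < ρ m)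
    (J : Set ℝ) (hJ_open : IsOpen J) (hJ_interval : J.OrdConnected) :
    (∀ γ : ℝ → R3 × R3, IsIntegralCurveD γ J → (∀ t ∈ J, deriv γ t ≠ 0) →
      IsHalfGeodesic (conformalMetric ρ) (hopf ∘ γ) J) ∧
    (∀ Γ : ℝ → RP2 × RP2, IsHalfGeodesic (conformalMetric ρ) Γ J →
      ∃ γ : ℝ → R3 × R3, IsIntegralCurveD γ J ∧ (∀ t ∈ J, deriv γ t ≠ 0) ∧
        (∀ t ∈ J, hopf (γ t) = Γ t) ∧
        ∀ γ' : ℝ → R3 × R3, IsIntegralCurveD γ' J → (∀ t ∈ J, hopf (γ' t) = Γ t) →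
          EqOn γ' γ J) :=
  ⟨fun _ hγ hreg => isHalfGeodesic_hopf hρ hρ_pos hJ_open hγ hreg,
    fun _ hΓ => exists_unique_integralCurve hρ hρ_pos hJ_open hΓ⟩
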